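/- Let $w,\mu>0$ and $L\ge 2$. On the torus $\mathbb T_L=\mathbb Z/L\mathbb Z$ consider diffusion-limited pair annihilation and deposition together with its activity $A(t)$, that is, the Markov chain $(\eta(t),A(t))$ on $\{0,1\}^{L}\times\mathbb N_0$ with generator $$(\tilde{\mathcal H}f)(\eta,A)=\sum_{k=0}^{L-1}\Big[\mu f(\bar\eta^{k,k+1},A)+w(\eta_k+\eta_{k+1})f(\bar\eta^{k,k+1},A+1)-\big(\mu+w(\eta_k+\eta_{k+1})\big)f(\eta,A)\Big],$$ where $\bar\eta^{k,k+1}$ is $\eta$ with the occupation numbers at the sites $k$ and $k+1$ flipped, and $A(0)=0$. Take $w=\tfrac12$ and $\mu=\tfrac12(1-\nu)$ with $\nu\in[0,1)$, so that $\nu=1-\mu/w$. Then for all $L\ge 2$ and $s\in\mathbb R$ the limit $$K_L(s)=\lim_{t\to\infty}\frac1{Lt}\ln \mathbb E_{\eta,0}\big[e^{sA(t)}\big]$$ exists and is the same for all initial configurations $\eta$ with an even number of particles, and $K_L$ is twice continuously differentiable. Let $V^{c}(L)=K_L''(s_c)$ be the second cumulant (the variance of the activity) at the critical point $s_c=\ln(1-\mu/w)=\ln\nu$;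 for $\nu=0$, where $s_c=-\infty$, the limit $V^{c}(L)=\lim_{s\to-\infty}K_L''(s)$ exists for every $L\ge2$ and is taken as the definition. As $L\to\infty$, $$V^{c}(L)\sim\frac{\nu^{2}}{2\pi\sqrt{1-\nu^{2}}}\,\ln L ,$$ where $f\sim g$ means $f-g=o(g)$ (so that for $\nu=0$ it says that $V^{c}(L)=0$ for all large $L$). In particular, $V^{c}(L)\to\infty$ logarithmically for $0<\nu<1$. -/

import Mathlib

open Filter Topology Asymptotics

noncomputable section

namespace DLPAD

/-- Configurations on the torus with `L` sites: `η k = true` means that site `k` is occupied. -/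
abbrev Config (L : ℕ) : Type := Fin L → Bool

/-- State space of the joint process: configuration and number of jumps so far. -/
abbrev State (L : ℕ) : Type := Config L × ℕ

/-- The right neighbour `k + 1` (modulo `L`) of the site `k`. -/
def next {L : ℕ} (k : Fin L) : Fin L :=
  ⟨(k.val + 1) % L, Nat.mod_lt _ (Nat.lt_of_le_of_lt (Nat.zero_le _) k.isLt)⟩

/-- The configuration `η` with the occupations of `k` and `k + 1` flipped. -/
def flipBond {L : ℕ} (k : Fin L) (η : Config L) : Config L :=
  fun j => if j = k ∨ j = next k then !(η j) else η j

/-- Occupation number, as a real number. -/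
def occ {L : ℕ} (η : Config L) (k : Fin L) : ℝ := if η k = true then 1 else 0

/-- Total particle number. -/
def numParticles {L : ℕ} (η : Config L) : ℕ := (Finset.univ.filter fun k => η k = true).card

/-- Generator of the joint process (configuration, activity): at every bond `(k, k + 1)` both
occupations are flipped with rate `μ` without changing the activity (deposition), and with rate
`w (η_k + η_{k+1})` with an increase of the activity by one (particle jump). -/
def generator (w μ : ℝ) (L : ℕ) : Module.End ℝ (State L → ℝ) where
  toFun f := fun x =>
    ∑ k : Fin L, (μ * f (flipBond k x.1, x.2)
      + w * (occ x.1 k + occ x.1 (next k)) * f (flipBond k x.1, x.2 + 1)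
      - (μ + w * (occ x.1 k + occ x.1 (next k))) * f x)
  map_add' f g := by
    funext x
    simp only [Pi.add_apply, ← Finset.sum_add_distrib]
    exact Finset.sum_congr rfl fun k _ => by ring
  map_smul' c f := by
    funext x
    simp only [Pi.smul_apply, smul_eq_mul, RingHom.id_apply, Finset.mul_sum]
    exact Finset.sum_congr rfl fun k _ => by ring

/-- The Markov semigroup `exp (t * generator)`. Since all rates are bounded, for bounded `f` it is
given by the exponential series, which converges uniformly, and `semigroup w μ L t f x` is the
expectation of `f` at time `t` for the joint process started in the state `x`. -/
def semigroup (w μ : ℝ) (L : ℕ) (t : ℝ) (f : State L → ℝ) (x : State L) : ℝ :=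
  ∑' n : ℕ, t ^ n / (n.factorial : ℝ) * ((generator w μ L) ^ n) f x

/-- Probability that the activity satisfies `A(t) = a`, for the process started from the
configuration `η` with `A(0) = 0`. -/
def activityProb (w μ : ℝ) (L : ℕ) (η : Config L) (t : ℝ) (a : ℕ) : ℝ :=
  semigroup w μ L t (fun x => if x.2 = a then 1 else 0) (η, 0)

/-- Moment generating function `E[exp (s A(t))]` of the activity, started from `η`. -/
def activityMGF (w μ : ℝ) (L : ℕ) (η : Config L) (s t : ℝ) : ℝ :=
  ∑' a : ℕ, activityProb w μ L η t a * Real.exp (s * a)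

/-- `K` is the long-time cumulant generating function (per site and unit time) of the activity in
the even sector: `K s = lim_{t → ∞} log E[exp (s A(t))] / (L t)` for every initial configuration
with an even number of particles. -/
def IsEvenCGF (w μ : ℝ) (L : ℕ) (K : ℝ → ℝ) : Prop :=
  ∀ (s : ℝ) (η : Config L), Even (numParticles η) →
    Tendsto (fun t : ℝ => Real.log (activityMGF w μ L η s t) / (L * t)) atTop (𝓝 (K s))

end DLPAD

end

noncomputable section

namespace DLPAD

/-! Averaging `exp (s A)` turns the joint process into a finite matrix problem: `E[exp (s A(t))]` is
`exp (t H) 1`, where H is the generator with its jump terms weighted by z = e^s (`activityMGF_eq`).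
So K is the exponential growth rate of H on the even sector, divided by L.

Under the Jordan-Wigner transform H becomes, on even configurations, a quadratic form in fermions
with antiperiodic boundary conditions (`fermiForm_apply_of_even`). No full diagonalisation is
needed; one eigenvector suffices. On a Gaussian state exp(½ Σ G d d) applied to the vacuum, each
annihilator acts as a linear combination of creators (`IsFock.annih_gaussState`), so the form
reduces to a scalar plus a quadratic expression in anticommuting creators, which vanishes if its
matrix is symmetric (`IsFock.fermiForm_gaussState`). In Fourier space this is one scalar Riccati
equation per momentum, solved by `pairing`, and the eigenvalue is -L(μ + 1/2) + ½ Σ ε(q) with ε² =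
`energySq`.

The eigenvector is positive on the even sector (`leadingVector_pos`): it is constant at s = 0, and
connectedness of the sector forbids it to lose positivity as s varies. The function 1 then lies
between two multiples of it, so its eigenvalue is the growth rate (`isEvenCGF_cgf`).

Hence K'' is half the mean over the momenta of the second s-derivative of ε. At criticality 2μ + z =
1 and, with u = 1 - cos q, ε² = u(2(1 - ν²) + ν²u): the gap closes at q = 0 and ε'' = ν²/√(2(1 -
ν²)u) + O(1) (`energyCurv_critical`). The antiperiodic momenta avoid q = 0, and the mean of
1/sin(q/2) over them is (2/π) log L + O(1) (`abs_sum_inv_sin_sub_le`), which yields the constant.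
For ν = 0 the second cumulant of each fixed L tends to 0 as z → 0. -/

/-! ### Jordan-Wigner operators and their anticommutation relations -/

/-- The configuration with the occupation of the single site `k` flipped. -/
def flipSite {L : ℕ} (k : Fin L) (η : Config L) : Config L := Function.update η k (!(η k))

/-- The sign `(-1)^n` of an occupation number. -/
def occSign (b : Bool) : ℂ := if b then -1 else 1

/-- The Jordan-Wigner sign, the parity of the number of particles to the left of `k`. -/
def jwSign {L : ℕ} (k : Fin L) (η : Config L) : ℂ := ∏ j ∈ Finset.Iio k, occSign (η j)

@[simp] lemma occSign_not (b : Bool) : occSign (!b) = -occSign b := by cases b <;> simp [occSign]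

lemma occSign_mul_self (b : Bool) : occSign b * occSign b = 1 := by cases b <;> simp [occSign]

@[simp] lemma flipSite_same {L : ℕ} (k : Fin L) (η : Config L) : flipSite k η k = !(η k) := by
  simp [flipSite]

lemma flipSite_ne {L : ℕ} {j k : Fin L} (h : j ≠ k) (η : Config L) : flipSite k η j = η j := by
  simp [flipSite, h]

@[simp] lemma flipSite_flipSite {L : ℕ} (k : Fin L) (η : Config L) :
    flipSite k (flipSite k η) = η := by
  funext j
  by_cases h : j = k
  · subst h; simp
  · simp [flipSite_ne h]

lemma flipSite_comm {L : ℕ} (j k : Fin L) (η : Config L) :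
    flipSite j (flipSite k η) = flipSite k (flipSite j η) := by
  funext i
  by_cases hj : i = j <;> by_cases hk : i = k
  · subst hj; subst hk; rfl
  · subst hj; simp [flipSite_ne hk]
  · subst hk; simp [flipSite_ne hj]
  · simp [flipSite_ne hj, flipSite_ne hk]

lemma jwSign_flipSite_of_le {L : ℕ} {j k : Fin L} (h : j ≤ k) (η : Config L) :
    jwSign j (flipSite k η) = jwSign j η := by
  refine Finset.prod_congr rfl fun i hi => ?_
  rw [flipSite_ne]
  exact ((Finset.mem_Iio.1 hi).trans_le h).ne

lemma jwSign_flipSite_of_lt {L : ℕ} {j k : Fin L} (h : k < j) (η : Config L) :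
    jwSign j (flipSite k η) = -jwSign j η := by
  have hk : k ∈ Finset.Iio j := Finset.mem_Iio.2 h
  rw [jwSign, jwSign, ← Finset.mul_prod_erase _ _ hk, ← Finset.mul_prod_erase _ _ hk,
    flipSite_same, occSign_not, neg_mul]
  congr 2
  refine Finset.prod_congr rfl fun i hi => ?_
  rw [flipSite_ne (Finset.ne_of_mem_erase hi)]

lemma jwSign_mul_self {L : ℕ} (k : Fin L) (η : Config L) : jwSign k η * jwSign k η = 1 := by
  rw [jwSign, ← Finset.prod_mul_distrib]
  exact Finset.prod_eq_one fun i _ => occSign_mul_self _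

/-- Operators on complex functions of the configuration. -/
abbrev Op (L : ℕ) : Type := (Config L → ℂ) →L[ℂ] (Config L → ℂ)

/-- The Jordan-Wigner transform of a one-site operator that changes the occupation of `k`. -/
def siteOp {L : ℕ} (u : Bool → ℂ) (k : Fin L) : Op L :=
  LinearMap.toContinuousLinearMap
    { toFun := fun f η => jwSign k η * u (η k) * f (flipSite k η)
      map_add' := fun f g => by funext η; simp [mul_add]
      map_smul' := fun r f => by funext η; simp; ring }

@[simp] lemma siteOp_apply {L : ℕ} (u : Bool → ℂ) (k : Fin L) (f : Config L → ℂ) (η : Config L) :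
    siteOp u k f η = jwSign k η * u (η k) * f (flipSite k η) := rfl

lemma siteOp_mul_of_lt {L : ℕ} (u v : Bool → ℂ) {j k : Fin L} (h : j < k) :
    siteOp u j * siteOp v k = -(siteOp v k * siteOp u j) := by
  ext f η
  simp only [mul_apply_eq_comp, siteOp_apply, neg_apply,
    Pi.neg_apply]
  rw [jwSign_flipSite_of_lt h, jwSign_flipSite_of_le h.le, flipSite_ne h.ne', flipSite_ne h.ne,
    flipSite_comm]
  ring

lemma siteOp_mul_of_ne {L : ℕ} (u v : Bool → ℂ) {j k : Fin L} (h : j ≠ k) :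
    siteOp u j * siteOp v k = -(siteOp v k * siteOp u j) := by
  rcases lt_or_gt_of_ne h with h | h
  · exact siteOp_mul_of_lt u v h
  · rw [siteOp_mul_of_lt v u h, neg_neg]

lemma siteOp_mul_same {L : ℕ} (u v : Bool → ℂ) (k : Fin L) (f : Config L → ℂ) (η : Config L) :
    (siteOp u k * siteOp v k) f η = u (η k) * v (!(η k)) * f η := by
  simp only [mul_apply_eq_comp, siteOp_apply, flipSite_same, flipSite_flipSite]
  rw [jwSign_flipSite_of_le le_rfl]
  linear_combination (u (η k) * v (!(η k)) * f η) * jwSign_mul_self k η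

/-- The fermionic annihilation operator. -/
def annih {L : ℕ} (k : Fin L) : Op L := siteOp (fun b => if b then 0 else 1) k

/-- The fermionic creation operator. -/
def creat {L : ℕ} (k : Fin L) : Op L := siteOp (fun b => if b then 1 else 0) k

lemma creat_mul_creat {L : ℕ} (j k : Fin L) : creat j * creat k = -(creat k * creat j) := by
  by_cases h : j = k
  · subst h
    ext f η
    simp only [creat, neg_apply, Pi.neg_apply, siteOp_mul_same]
    cases η j <;> simp
  · exact siteOp_mul_of_ne _ _ h

lemma annih_mul_creat {L : ℕ} (j k : Fin L) :
    annih j * creat k = (if j = k then 1 else 0) - creat k * annih j := by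
  by_cases h : j = k
  · subst h
    ext f η
    simp only [annih, creat, if_true, sub_apply, Pi.sub_apply, siteOp_mul_same,
      one_apply_eq_self]
    cases η j <;> simp
  · rw [if_neg h, zero_sub]
    exact siteOp_mul_of_ne _ _ h

/-- The sign of the bond `(k, k + 1)` under antiperiodic boundary conditions. -/
def bondSign {L : ℕ} (k : Fin L) : ℂ := if k.val + 1 < L then 1 else -1

lemma next_ne {L : ℕ} (hL : 2 ≤ L) (k : Fin L) : next k ≠ k := by
  intro h
  have h1 := congrArg Fin.val h
  simp only [next] at h1
  rcases Nat.lt_or_ge (k.val + 1) L with h2 | h2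
  · rw [Nat.mod_eq_of_lt h2] at h1; omega
  · have : k.val + 1 = L := by have := k.isLt; omega
    rw [this, Nat.mod_self] at h1; omega

lemma flipSite_flipSite_next {L : ℕ} (hL : 2 ≤ L) (k : Fin L) (η : Config L) :
    flipSite (next k) (flipSite k η) = flipBond k η := by
  have hn := next_ne hL k
  funext j
  by_cases h1 : j = k
  · subst h1; simp [flipBond, flipSite_ne hn.symm]
  · by_cases h2 : j = next k
    · subst h2; simp [flipBond, flipSite_ne hn]
    · simp [flipBond, flipSite_ne h1, flipSite_ne h2, h1, h2]

lemma prod_occSign {L : ℕ} (η : Config L) : ∏ j, occSign (η j) = (-1) ^ numParticles η := by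
  simp only [occSign, numParticles, Finset.prod_ite, Finset.prod_const, one_pow, mul_one]

lemma prod_occSign_of_even {L : ℕ} {η : Config L} (h : Even (numParticles η)) :
    ∏ j, occSign (η j) = 1 := by
  rw [prod_occSign, h.neg_one_pow]

/-- For a bond inside the chain the two strings cancel except for the sign of site `k`. On the bond
that closes the torus the string runs over all other sites; even parity reduces it to the sign of
`k` as well, with the opposite overall sign, which the antiperiodic `bondSign` absorbs. -/
lemma siteOp_mul_next {L : ℕ} (hL : 2 ≤ L) (u v : Bool → ℂ) (k : Fin L) (f : Config L → ℂ)
    {η : Config L} (h : Even (numParticles η)) :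
    bondSign k * (siteOp u k * siteOp v (next k)) f η =
      -(occSign (η k) * u (η k) * v (η (next k)) * f (flipBond k η)) := by
  simp only [mul_apply_eq_comp, siteOp_apply]
  rw [flipSite_ne (next_ne hL k), flipSite_flipSite_next hL]
  by_cases hk : k.val + 1 < L
  · have hv : (next k).val = k.val + 1 := by simp [next, Nat.mod_eq_of_lt hk]
    have hlt : k < next k := by rw [Fin.lt_def, hv]; omega
    rw [jwSign_flipSite_of_lt hlt]
    have h1 : jwSign (next k) η = occSign (η k) * jwSign k η := by
      have : Finset.Iio (next k) = insert k (Finset.Iio k) := by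
        ext j
        simp only [Finset.mem_Iio, Finset.mem_insert, Fin.lt_def, hv, Fin.ext_iff]
        omega
      rw [jwSign, this, Finset.prod_insert (by simp)]; rfl
    rw [h1, bondSign, if_pos hk]
    linear_combination (-(occSign (η k) * u (η k) * v (η (next k)) * f (flipBond k η))) *
      jwSign_mul_self k η
  · have hkL : k.val + 1 = L := by have := k.isLt; omega
    have hv : (next k).val = 0 := by simp [next, hkL]
    have hle : next k ≤ k := by rw [Fin.le_def, hv]; omega
    have h0 : jwSign (next k) (flipSite k η) = 1 := by
      have : Finset.Iio (next k) = ∅ := by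
        ext j
        simp [Fin.lt_def, hv]
      rw [jwSign, this, Finset.prod_empty]
    have h1 : occSign (η k) * jwSign k η = 1 := by
      rw [← prod_occSign_of_even h]
      have : (Finset.univ : Finset (Fin L)) = insert k (Finset.Iio k) := by
        ext j
        simp only [Finset.mem_Iio, Finset.mem_insert, Fin.lt_def, Fin.ext_iff, Finset.mem_univ,
          true_iff]
        have := j.isLt; omega
      rw [this, Finset.prod_insert (by simp)]; rfl
    have h2 : jwSign k η = occSign (η k) := by
      linear_combination occSign (η k) * h1 - jwSign k η * occSign_mul_self (η k)
    rw [h0, bondSign, if_neg hk, h2]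
    ring

/-- The tilted generator acting on functions of the configuration. -/
def tilted (μ z : ℝ) {L : ℕ} (f : Config L → ℝ) (η : Config L) : ℝ :=
  ∑ k : Fin L, ((μ + z / 2 * (occ η k + occ η (next k))) * f (flipBond k η)
    - (μ + 1 / 2 * (occ η k + occ η (next k))) * f η)

lemma next_injective {L : ℕ} : Function.Injective (next : Fin L → Fin L) := by
  intro j k h
  have h1 := congrArg Fin.val h
  simp only [next] at h1
  have hj := j.isLt
  have hk := k.isLt
  ext
  rcases Nat.lt_or_ge (j.val + 1) L with h2 | h2 <;> rcases Nat.lt_or_ge (k.val + 1) L with h3 | h3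
  · rw [Nat.mod_eq_of_lt h2, Nat.mod_eq_of_lt h3] at h1; omega
  · have : k.val + 1 = L := by omega
    rw [Nat.mod_eq_of_lt h2, this, Nat.mod_self] at h1; omega
  · have : j.val + 1 = L := by omega
    rw [Nat.mod_eq_of_lt h3, this, Nat.mod_self] at h1; omega
  · omega

lemma sum_next {L : ℕ} {M : Type*} [AddCommMonoid M] (f : Fin L → M) :
    ∑ k, f (next k) = ∑ k, f k :=
  (Equiv.ofBijective _ (Finite.injective_iff_bijective.1 next_injective)).sum_comp f

/-! ### Gaussian eigenvectors of quadratic fermionic forms -/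

lemma mul_pow_of_mul_eq {R : Type*} [Ring R] {c P B : R} (h : c * P = P * c + B)
    (hB : Commute P B) (n : ℕ) : c * P ^ (n + 1) = P ^ (n + 1) * c + (n + 1 : ℕ) • (P ^ n * B) := by
  induction n with
  | zero => simpa using h
  | succ n ih =>
    rw [pow_succ P (n + 1), ← mul_assoc, ih, add_mul, mul_assoc, h, mul_add, smul_mul_assoc,
      mul_assoc, ← hB.eq, ← mul_assoc (P ^ n), ← pow_succ, succ_nsmul (P ^ (n + 1) * B) (n + 1),
      ← mul_assoc, add_assoc, add_comm (P ^ (n + 1) * B)]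

/-- The commutator with `c` is a derivation, and it sends `P` to an element commuting with `P`, so
it acts on power series in `P` as differentiation times `B`. -/
lemma mul_exp_of_mul_eq {R : Type*} [NormedRing R] [NormedAlgebra ℂ R] [CompleteSpace R]
    {c P B : R} (h : c * P = P * c + B) (hB : Commute P B) :
    c * NormedSpace.exp P = NormedSpace.exp P * c + NormedSpace.exp P * B := by
  have h0 := NormedSpace.exp_series_hasSum_exp' (𝕂 := ℂ) P
  have h1 := h0.mul_left c
  have h2 := h0.mul_right c
  have h3 := h1.sub h2
  have h4 := h0.mul_right B
  have h5 : HasSum (fun n : ℕ => c * (((n.factorial : ℂ)⁻¹) • P ^ n)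
      - (((n.factorial : ℂ)⁻¹) • P ^ n) * c) (NormedSpace.exp P * B) := by
    -- The constant term commutes with `c`, so the series of commutators starts at index 1; after
    -- the shift, (n + 1)/(n + 1)! = 1/n! restores the exponential.
    rw [← hasSum_nat_add_iff' 1]
    simp only [Finset.range_one, Finset.sum_singleton, pow_zero, Nat.factorial_zero, Nat.cast_one,
      inv_one, one_smul, mul_one, one_mul, sub_self, sub_zero]
    refine (congrArg (HasSum · _) (funext fun n => ?_)).mpr h4
    rw [mul_smul_comm, mul_pow_of_mul_eq h hB, smul_add, smul_mul_assoc, add_sub_cancel_left,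
      smul_mul_assoc, ← Nat.cast_smul_eq_nsmul ℂ, smul_smul, Nat.factorial_succ]
    congr 1
    have h1 : ((n + 1 : ℕ) : ℂ) ≠ 0 := Nat.cast_ne_zero.2 n.succ_ne_zero
    have h2 : (n.factorial : ℂ) ≠ 0 := Nat.cast_ne_zero.2 n.factorial_ne_zero
    rw [Nat.cast_mul]
    field_simp
  rw [← sub_eq_iff_eq_add', h3.unique h5]

section Fock

variable {L : ℕ} {E : Type*} [NormedAddCommGroup E] [NormedSpace ℂ E]

/-- Annihilation operators `c` and creation operators `d` with vacuum `v`. -/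
structure IsFock (c d : Fin L → (E →L[ℂ] E)) (v : E) : Prop where
  creat_mul_creat : ∀ j k, d j * d k = -(d k * d j)
  annih_mul_creat : ∀ j k, c j * d k = (if j = k then 1 else 0) - d k * c j
  annih_vacuum : ∀ k, c k v = 0

/-- Linear combinations of creation operators. -/
def linCreat (d : Fin L → (E →L[ℂ] E)) (N : Matrix (Fin L) (Fin L) ℂ) (k : Fin L) : E →L[ℂ] E :=
  ∑ y, N k y • d y

/-- Quadratic form in the creation operators. -/
def quadCreat (d : Fin L → (E →L[ℂ] E)) (N : Matrix (Fin L) (Fin L) ℂ) : E →L[ℂ] E :=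
  ∑ x, ∑ y, N x y • (d x * d y)

variable {c d : Fin L → (E →L[ℂ] E)} {v : E}

lemma sum_linCreat_mul_linCreat (M N : Matrix (Fin L) (Fin L) ℂ) :
    ∑ k, linCreat d M k * linCreat d N k = quadCreat d (M.transpose * N) := by
  simp only [linCreat, quadCreat, Finset.sum_mul_sum, Matrix.mul_apply, Matrix.transpose_apply,
    Finset.sum_smul, smul_mul_smul_comm]
  rw [Finset.sum_comm]
  refine Finset.sum_congr rfl fun x _ => ?_
  rw [Finset.sum_comm]

lemma linCreat_one (k : Fin L) : linCreat d 1 k = d k := by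
  simp [linCreat, Matrix.one_apply]

lemma sum_creat_mul_linCreat (N : Matrix (Fin L) (Fin L) ℂ) :
    ∑ k, d k * linCreat d N k = quadCreat d N := by
  simpa [linCreat_one] using sum_linCreat_mul_linCreat (d := d) 1 N

lemma quadCreat_add (M N : Matrix (Fin L) (Fin L) ℂ) :
    quadCreat d (M + N) = quadCreat d M + quadCreat d N := by
  simp [quadCreat, add_smul, Finset.sum_add_distrib]

lemma quadCreat_smul (a : ℂ) (N : Matrix (Fin L) (Fin L) ℂ) :
    quadCreat d (a • N) = a • quadCreat d N := by
  simp [quadCreat, Finset.smul_sum, smul_smul]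

lemma quadCreat_neg (N : Matrix (Fin L) (Fin L) ℂ) : quadCreat d (-N) = -quadCreat d N := by
  simpa using quadCreat_smul (d := d) (-1) N

namespace IsFock

lemma quadCreat_eq_zero (h : IsFock c d v) {N : Matrix (Fin L) (Fin L) ℂ}
    (hN : N.transpose = N) : quadCreat d N = 0 := by
  have h1 : quadCreat d N = -quadCreat d N := by
    conv_lhs => rw [quadCreat, Finset.sum_comm]
    rw [quadCreat, ← Finset.sum_neg_distrib]
    refine Finset.sum_congr rfl fun x _ => ?_
    rw [← Finset.sum_neg_distrib]
    refine Finset.sum_congr rfl fun y _ => ?_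
    rw [h.creat_mul_creat y x, smul_neg, ← Matrix.transpose_apply N, hN]
  have h2 : (2 : ℂ) • quadCreat d N = 0 := by
    rw [two_smul]; nth_rw 2 [h1]; exact add_neg_cancel _
  exact (smul_eq_zero.1 h2).resolve_left two_ne_zero

lemma commute_quadCreat_creat (h : IsFock c d v) (N : Matrix (Fin L) (Fin L) ℂ) (k : Fin L) :
    Commute (quadCreat d N) (d k) := by
  refine Commute.sum_left _ _ _ fun x _ => Commute.sum_left _ _ _ fun y _ => Commute.smul_left ?_ _
  rw [Commute, SemiconjBy, mul_assoc, h.creat_mul_creat y k, mul_neg, ← mul_assoc,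
    h.creat_mul_creat x k, neg_mul, neg_neg, mul_assoc]

lemma commute_quadCreat_linCreat (h : IsFock c d v) (M N : Matrix (Fin L) (Fin L) ℂ) (k : Fin L) :
    Commute (quadCreat d M) (linCreat d N k) :=
  Commute.sum_right _ _ _ fun _ _ => (h.commute_quadCreat_creat M _).smul_right _

lemma annih_mul_linCreat (h : IsFock c d v) (N : Matrix (Fin L) (Fin L) ℂ) (j k : Fin L) :
    c j * linCreat d N k = N k j • 1 - linCreat d N k * c j := by
  simp only [linCreat, Finset.mul_sum, Finset.sum_mul, mul_smul_comm, smul_mul_assoc,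
    h.annih_mul_creat, smul_sub, Finset.sum_sub_distrib]
  simp

lemma annih_mul_quadCreat (h : IsFock c d v) {G : Matrix (Fin L) (Fin L) ℂ}
    (hG : G.transpose = -G) (k : Fin L) :
    c k * quadCreat d G = quadCreat d G * c k + (2 : ℂ) • linCreat d G k := by
  have h1 : ∑ x, G x k • d x = -linCreat d G k := by
    rw [linCreat, ← Finset.sum_neg_distrib]
    refine Finset.sum_congr rfl fun x _ => ?_
    rw [← Matrix.transpose_apply G, hG, Matrix.neg_apply, neg_smul]
  rw [← sum_creat_mul_linCreat, Finset.mul_sum, Finset.sum_mul]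
  have h2 : ∀ x, c k * (d x * linCreat d G x) =
      d x * linCreat d G x * c k + ((if k = x then 1 else 0) * linCreat d G x
        - G x k • d x) := by
    intro x
    rw [← mul_assoc, h.annih_mul_creat, sub_mul, mul_assoc, h.annih_mul_linCreat, mul_sub,
      mul_smul_comm, mul_one, mul_assoc]
    abel
  simp only [h2, Finset.sum_add_distrib, Finset.sum_sub_distrib, h1]
  simp [two_smul]

end IsFock

/-- The Gaussian fermionic state with pairing matrix `G`. -/
def gaussState (d : Fin L → (E →L[ℂ] E)) (v : E) (G : Matrix (Fin L) (Fin L) ℂ) : E :=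
  NormedSpace.exp ((1 / 2 : ℂ) • quadCreat d G) v

lemma IsFock.annih_gaussState [CompleteSpace E] (h : IsFock c d v)
    {G : Matrix (Fin L) (Fin L) ℂ} (hG : G.transpose = -G) (k : Fin L) :
    c k (gaussState d v G) = linCreat d G k (gaussState d v G) := by
  have h1 : c k * ((1 / 2 : ℂ) • quadCreat d G) =
      ((1 / 2 : ℂ) • quadCreat d G) * c k + linCreat d G k := by
    rw [mul_smul_comm, h.annih_mul_quadCreat hG, smul_add, smul_smul, smul_mul_assoc]
    norm_num
  have h2 : Commute ((1 / 2 : ℂ) • quadCreat d G) (linCreat d G k) :=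
    (h.commute_quadCreat_linCreat G G k).smul_left _
  have h3 := congrArg (fun T : E →L[ℂ] E => T v) (mul_exp_of_mul_eq h1 h2)
  have h4 : Commute (NormedSpace.exp ((1 / 2 : ℂ) • quadCreat d G)) (linCreat d G k) :=
    let _ : NormedAlgebra ℚ (E →L[ℂ] E) := NormedAlgebra.restrictScalars ℚ ℂ _
    h2.exp_left
  rw [h4.eq] at h3
  simpa [h.annih_vacuum, gaussState] using h3

/-- Every term of the exponential except the vacuum begins with a creator, which `φ` kills. With
evaluation at the empty configuration as `φ`, this normalises the eigenvector and shows that it is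
nonzero. -/
lemma apply_gaussState [CompleteSpace E] {φ : E →L[ℂ] ℂ} (hφ : ∀ k x, φ (d k x) = 0)
    (G : Matrix (Fin L) (Fin L) ℂ) : φ (gaussState d v G) = φ v := by
  set P : E →L[ℂ] E := (1 / 2 : ℂ) • quadCreat d G with hP
  have hz : ∀ f, φ (P f) = 0 := by
    intro f
    simp [hP, quadCreat, sum_apply, hφ]
  have h0 := NormedSpace.exp_series_hasSum_exp' (𝕂 := ℂ) P
  have h1 := h0.mapL (φ.comp (ContinuousLinearMap.apply ℂ E v))
  have h2 := h1.unique (hasSum_single 0 ?_)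
  · refine h2.trans ?_
    simp
  · intro n hn
    obtain ⟨m, rfl⟩ := Nat.exists_eq_succ_of_ne_zero hn
    simp [pow_succ', hz]

lemma continuous_gaussState [CompleteSpace E] {X : Type*} [TopologicalSpace X]
    {G : X → Matrix (Fin L) (Fin L) ℂ} (hG : ∀ x y, Continuous fun t => G t x y) :
    Continuous fun t => gaussState d v (G t) := by
  have h0 : Continuous fun t => quadCreat d (G t) := by
    unfold quadCreat
    exact continuous_finsetSum _ fun x _ => continuous_finsetSum _ fun y _ =>
      (hG x y).smul continuous_const
  have h1 : Continuous fun t => (1 / 2 : ℂ) • quadCreat d (G t) :=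
    (continuous_const (y := (1 / 2 : ℂ))).smul h0
  let _ : NormedAlgebra ℚ (E →L[ℂ] E) := NormedAlgebra.restrictScalars ℚ ℂ _
  exact ((NormedSpace.exp_continuous (𝔸 := E →L[ℂ] E)).comp h1).clm_apply continuous_const

/-- The antiperiodic shift matrix. -/
def shiftMatrix (L : ℕ) : Matrix (Fin L) (Fin L) ℂ :=
  fun x y => if y = next x then bondSign x else 0

lemma shiftMatrix_mul_apply (G : Matrix (Fin L) (Fin L) ℂ) (x y : Fin L) :
    (shiftMatrix L * G) x y = bondSign x * G (next x) y := by
  simp [Matrix.mul_apply, shiftMatrix]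

lemma linCreat_shiftMatrix (k : Fin L) :
    linCreat d (shiftMatrix L) k = bondSign k • d (next k) := by
  simp [linCreat, shiftMatrix, ite_smul]

lemma linCreat_shiftMatrix_mul (G : Matrix (Fin L) (Fin L) ℂ) (k : Fin L) :
    linCreat d (shiftMatrix L * G) k = bondSign k • linCreat d G (next k) := by
  simp only [linCreat, shiftMatrix_mul_apply, Finset.smul_sum, smul_smul]

/-- The quadratic fermionic form of the tilted generator with antiperiodic boundary conditions. -/
def fermiForm (c d : Fin L → (E →L[ℂ] E)) (μ z : ℂ) : E →L[ℂ] E :=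
  ∑ k : Fin L, (-(d k * c k) - μ • 1
    + bondSign k • (-μ • (c k * c (next k)) + (μ + z) • (d k * d (next k))
      + (μ + z / 2) • (d k * c (next k) + d (next k) * c k)))

/-- Annihilators are replaced by creators through `annih_gaussState`. The only scalars, besides the
constant -Lμ, come from moving an annihilator past a creator in the pair-annihilation term; they sum
to the trace. What remains is `quadCreat d M`, which is zero for symmetric `M` because creators
anticommute. -/
lemma IsFock.fermiForm_gaussState [CompleteSpace E] (h : IsFock c d v) (μ z : ℂ)
    {G : Matrix (Fin L) (Fin L) ℂ} (hG : G.transpose = -G) {M : Matrix (Fin L) (Fin L) ℂ}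
    (hM : M = -G + μ • ((shiftMatrix L * G).transpose * G) + (μ + z) • shiftMatrix L
      + (μ + z / 2) • (shiftMatrix L * G + (shiftMatrix L).transpose * G))
    (hsym : M.transpose = M) :
    fermiForm c d μ z (gaussState d v G) =
      (-(L * μ) - μ * (shiftMatrix L * G).trace) • gaussState d v G := by
  have hc : ∀ k, c k (gaussState d v G) = linCreat d G k (gaussState d v G) := h.annih_gaussState hG
  -- From here on only the linear relations `hc` matter, not the exponential.
  generalize gaussState d v G = ψ at hc ⊢
  have hS := linCreat_shiftMatrix (d := d)
  have hSG := linCreat_shiftMatrix_mul (d := d) G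
  have hSd := shiftMatrix_mul_apply G
  generalize shiftMatrix L = S at hM hS hSG hSd ⊢
  have hterm : ∀ k : Fin L, (-(d k * c k) - μ • 1
      + bondSign k • (-μ • (c k * c (next k)) + (μ + z) • (d k * d (next k))
      + (μ + z / 2) • (d k * c (next k) + d (next k) * c k)) : E →L[ℂ] E) ψ =
      (-(d k * linCreat d G k) + μ • (linCreat d (S * G) k * linCreat d G k)
        + (μ + z) • (d k * linCreat d S k) + (μ + z / 2) • (d k * linCreat d (S * G) k
          + linCreat d S k * linCreat d G k) - (μ + μ * (S * G) k k) • 1 : E →L[ℂ] E) ψ := by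
    intro k
    have h1 : c k (linCreat d G (next k) ψ) =
        G (next k) k • ψ - linCreat d G (next k) (linCreat d G k ψ) := by
      have := congrArg (fun T : E →L[ℂ] E => T ψ) (h.annih_mul_linCreat G k (next k))
      simpa [hc] using this
    rw [hS, hSG, hSd]
    simp only [add_apply, sub_apply, neg_apply, smul_apply,
      mul_apply_eq_comp, one_apply_eq_self, hc, h1, map_smul]
    module
  have hsum : fermiForm c d μ z ψ =
      (quadCreat d M - (L * μ + μ * (S * G).trace) • 1 : E →L[ℂ] E) ψ := by
    rw [fermiForm, sum_apply, Finset.sum_congr rfl fun k _ => hterm k, ← sum_apply]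
    congr 1
    rw [Finset.sum_sub_distrib, ← Finset.sum_smul, hM]
    simp only [Finset.sum_add_distrib, Finset.sum_neg_distrib, ← Finset.smul_sum,
      sum_creat_mul_linCreat, sum_linCreat_mul_linCreat, quadCreat_add, quadCreat_smul,
      quadCreat_neg, ← Finset.mul_sum, Matrix.trace, Matrix.diag]
    simp
  rw [hsum, h.quadCreat_eq_zero hsym]
  simp only [sub_apply, zero_apply, smul_apply, one_apply_eq_self]
  module

end Fock

/-! ### The tilted generator as a fermionic form -/

lemma annih_vacuum {L : ℕ} (k : Fin L) : annih k (Pi.single (fun _ => false) 1) = 0 := by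
  funext η
  simp only [annih, siteOp_apply, Pi.zero_apply]
  cases h : η k
  · have : flipSite k η ≠ fun _ => false := fun h1 => by
      have := congrFun h1 k
      simp [h] at this
    simp [this]
  · simp

lemma isFock_siteOp (L : ℕ) :
    IsFock (E := Config L → ℂ) annih creat (Pi.single (fun _ => false) 1) where
  creat_mul_creat := creat_mul_creat
  annih_mul_creat := annih_mul_creat
  annih_vacuum := annih_vacuum

lemma fermiForm_apply_of_even {L : ℕ} (hL : 2 ≤ L) (μ z : ℝ) (f : Config L → ℂ) {η : Config L}
    (h : Even (numParticles η)) :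
    fermiForm (annih (L := L)) creat μ z f η =
      ∑ k : Fin L, (((μ + z / 2 * (occ η k + occ η (next k)) : ℝ) : ℂ) * f (flipBond k η)
        - ((μ + 1 / 2 * (occ η k + occ η (next k)) : ℝ) : ℂ) * f η) := by
  -- By translation invariance the exit rates sum to the particle number, which is the number
  -- operator in `fermiForm`.
  have hdiag : ∑ k : Fin L, ((μ + 1 / 2 * (occ η k + occ η (next k)) : ℝ) : ℂ) * f η =
      ∑ k : Fin L, ((μ + occ η k : ℝ) : ℂ) * f η := by
    rw [← Finset.sum_mul, ← Finset.sum_mul]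
    congr 1
    rw [← Complex.ofReal_sum, ← Complex.ofReal_sum, Complex.ofReal_inj, Finset.sum_add_distrib,
      Finset.sum_add_distrib, ← Finset.mul_sum, Finset.sum_add_distrib,
      sum_next (fun k => occ η k)]
    ring
  rw [Finset.sum_sub_distrib, hdiag, ← Finset.sum_sub_distrib, fermiForm,
    sum_apply, Finset.sum_apply]
  refine Finset.sum_congr rfl fun k _ => ?_
  have hdc : creat (next k) * annih k = -(annih k * creat (next k)) := by
    rw [annih_mul_creat, if_neg (next_ne hL k).symm, zero_sub, neg_neg]
  rw [hdc]
  have e1 := siteOp_mul_next hL (fun b => if b then 0 else 1) (fun b => if b then 0 else 1) k f h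
  have e2 := siteOp_mul_next hL (fun b => if b then 1 else 0) (fun b => if b then 1 else 0) k f h
  have e3 := siteOp_mul_next hL (fun b => if b then 1 else 0) (fun b => if b then 0 else 1) k f h
  have e4 := siteOp_mul_next hL (fun b => if b then 0 else 1) (fun b => if b then 1 else 0) k f h
  have e5 := siteOp_mul_same (fun b => if b then 1 else 0) (fun b => if b then 0 else 1) k f η
  simp only [← annih.eq_1, ← creat.eq_1] at e1 e2 e3 e4 e5
  simp only [add_apply, sub_apply,
    neg_apply, smul_apply, Pi.add_apply, Pi.sub_apply,
    Pi.neg_apply, Pi.smul_apply, smul_eq_mul, one_apply_eq_self, e5]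
  have key : ∀ x y v w : ℂ, bondSign k * (-(μ : ℂ) * x + (μ + z) * y + (μ + z / 2) * (v + -w)) =
      -(μ : ℂ) * (bondSign k * x) + (μ + z) * (bondSign k * y) +
        (μ + z / 2) * (bondSign k * v - bondSign k * w) := by intros; ring
  rw [key, e1, e2, e3, e4]
  simp only [occ, occSign]
  cases η k <;> cases η (next k) <;> simp <;> ring

/-! ### Fourier analysis with antiperiodic momenta -/

/-- The antiperiodic momenta. -/
def momentum (L j : ℕ) : ℝ := (2 * j + 1) * Real.pi / L

lemma momentum_pos {L j : ℕ} (hj : j < L) : 0 < momentum L j := by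
  have : (0 : ℝ) < L := Nat.cast_pos.2 (by omega)
  unfold momentum; positivity

lemma momentum_lt {L j : ℕ} (hj : j < L) : momentum L j < 2 * Real.pi := by
  have hL : (0 : ℝ) < L := Nat.cast_pos.2 (by omega)
  have h1 : (j : ℝ) + 1 ≤ L := by exact_mod_cast hj
  rw [momentum, div_lt_iff₀ hL]
  nlinarith [Real.pi_pos]

lemma momentum_rev {L : ℕ} (j : Fin L) :
    momentum L (Fin.rev j) = 2 * Real.pi - momentum L j := by
  have hL : (L : ℝ) ≠ 0 := Nat.cast_ne_zero.2 (by have := j.isLt; omega)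
  have h1 : ((Fin.rev j : Fin L) : ℕ) + j + 1 = L := by rw [Fin.val_rev]; have := j.isLt; omega
  have h2 : (((Fin.rev j : Fin L) : ℕ) : ℝ) = L - j - 1 := by
    have : ((((Fin.rev j : Fin L) : ℕ) + j + 1 : ℕ) : ℝ) = L := by rw [h1]
    push_cast at this; linarith
  rw [momentum, momentum, h2]
  field_simp
  ring

lemma cos_momentum_rev {L : ℕ} (j : Fin L) :
    Real.cos (momentum L (Fin.rev j)) = Real.cos (momentum L j) := by
  rw [momentum_rev, Real.cos_two_pi_sub]

lemma sin_momentum_rev {L : ℕ} (j : Fin L) :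
    Real.sin (momentum L (Fin.rev j)) = -Real.sin (momentum L j) := by
  rw [momentum_rev, Real.sin_two_pi_sub]

/-- The phase `exp (i q)` of the momentum `q`. -/
def phase (L : ℕ) (j : Fin L) : ℂ := Complex.exp (momentum L j * Complex.I)

lemma phase_eq {L : ℕ} (j : Fin L) :
    phase L j = Real.cos (momentum L j) + Real.sin (momentum L j) * Complex.I := by
  rw [phase, Complex.exp_mul_I, Complex.ofReal_cos, Complex.ofReal_sin]

lemma phase_ne_zero {L : ℕ} (j : Fin L) : phase L j ≠ 0 := Complex.exp_ne_zero _

lemma phase_inv {L : ℕ} (j : Fin L) :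
    (phase L j)⁻¹ = Real.cos (momentum L j) - Real.sin (momentum L j) * Complex.I := by
  rw [phase, ← Complex.exp_neg, ← neg_mul, Complex.exp_mul_I, Complex.cos_neg, Complex.sin_neg,
    Complex.ofReal_cos, Complex.ofReal_sin]
  ring

lemma phase_rev {L : ℕ} (j : Fin L) : phase L (Fin.rev j) = (phase L j)⁻¹ := by
  rw [phase_eq, phase_inv, cos_momentum_rev, sin_momentum_rev]
  push_cast
  ring

lemma phase_pow_card {L : ℕ} (j : Fin L) : phase L j ^ L = -1 := by
  have hL : (L : ℂ) ≠ 0 := Nat.cast_ne_zero.2 (by have := j.isLt; omega)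
  rw [phase, ← Complex.exp_nat_mul, momentum]
  have : (L : ℂ) * (((2 * (j : ℕ) + 1) * Real.pi / L : ℝ) * Complex.I) =
      Real.pi * Complex.I + (j : ℕ) * (2 * Real.pi * Complex.I) := by
    push_cast
    field_simp
    ring
  rw [this, Complex.exp_add, Complex.exp_nat_mul_two_pi_mul_I, Complex.exp_pi_mul_I, mul_one]

lemma phase_injective {L : ℕ} : Function.Injective (phase L) := by
  intro j k h
  have hj := j.isLt
  have hk := k.isLt
  have hL : (0 : ℝ) < L := Nat.cast_pos.2 (by omega)
  rw [phase, phase, Complex.exp_eq_exp_iff_exists_int] at h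
  obtain ⟨n, hn⟩ := h
  have h1 : (momentum L j : ℂ) = ((momentum L k + n * (2 * Real.pi) : ℝ) : ℂ) := by
    have := Complex.I_ne_zero
    have h2 : ((momentum L j : ℂ) - (momentum L k + n * (2 * Real.pi))) * Complex.I = 0 := by
      linear_combination hn
    have h3 := (mul_eq_zero.1 h2).resolve_right this
    push_cast
    linear_combination h3
  have h2 := Complex.ofReal_injective h1
  have h3 : momentum L j * L = (2 * (j : ℕ) + 1) * Real.pi := div_mul_cancel₀ _ hL.ne'
  have h4 : momentum L k * L = (2 * (k : ℕ) + 1) * Real.pi := div_mul_cancel₀ _ hL.ne'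
  have h5 : 2 * Real.pi * (((j : ℕ) : ℝ) - ((k : ℕ) : ℝ) - n * L) = 0 := by
    linear_combination (-h3) + h4 + L * h2
  have h6 := (mul_eq_zero.1 h5).resolve_left (by positivity)
  have h7 : ((j : ℕ) : ℤ) - ((k : ℕ) : ℤ) = n * L := by
    have : (((j : ℕ) : ℤ) : ℝ) - (((k : ℕ) : ℤ) : ℝ) = ((n * L : ℤ) : ℝ) := by
      push_cast; linarith
    exact_mod_cast this
  have h8 : n = 0 := by
    by_contra h9
    rcases lt_or_gt_of_ne h9 with h | h
    · have : n * (L : ℤ) ≤ -1 * L := by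
        apply mul_le_mul_of_nonneg_right (by omega) (by positivity)
      omega
    · have : 1 * (L : ℤ) ≤ n * L := by
        apply mul_le_mul_of_nonneg_right (by omega) (by positivity)
      omega
  rw [h8, zero_mul] at h7
  ext
  omega

/-- Plane waves as columns. -/
def waveMatrix (L : ℕ) : Matrix (Fin L) (Fin L) ℂ := fun x j => phase L j ^ (x : ℕ)

/-- The inverse of the matrix of plane waves. -/
def waveInv (L : ℕ) : Matrix (Fin L) (Fin L) ℂ := fun j x => (L : ℂ)⁻¹ * ((phase L j)⁻¹) ^ (x : ℕ)

lemma waveInv_mul_waveMatrix (L : ℕ) : waveInv L * waveMatrix L = 1 := by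
  ext j k
  have hL : (L : ℂ) ≠ 0 := Nat.cast_ne_zero.2 (by have := j.isLt; omega)
  have h1 : (waveInv L * waveMatrix L) j k =
      (L : ℂ)⁻¹ * ∑ x : Fin L, ((phase L j)⁻¹ * phase L k) ^ (x : ℕ) := by
    simp only [Matrix.mul_apply, waveInv, waveMatrix, Finset.mul_sum, mul_pow, mul_assoc]
  rw [h1, Fin.sum_univ_eq_sum_range (fun x => ((phase L j)⁻¹ * phase L k) ^ x) L]
  by_cases h : j = k
  · subst h
    simp [inv_mul_cancel₀ (phase_ne_zero j), hL]
  · have hne : (phase L j)⁻¹ * phase L k ≠ 1 := by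
      intro h2
      apply h
      apply phase_injective
      rw [inv_mul_eq_one₀ (phase_ne_zero j)] at h2
      exact h2
    rw [geom_sum_eq hne, mul_pow, inv_pow, phase_pow_card, phase_pow_card, Matrix.one_apply_ne h]
    norm_num

lemma waveMatrix_mul_waveInv (L : ℕ) : waveMatrix L * waveInv L = 1 :=
  mul_eq_one_comm.1 (waveInv_mul_waveMatrix L)

/-- The translation covariant antiperiodic matrix with symbol `m`. -/
def symbolMatrix {L : ℕ} (m : Fin L → ℂ) : Matrix (Fin L) (Fin L) ℂ :=
  waveMatrix L * Matrix.diagonal m * waveInv L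

lemma symbolMatrix_mul {L : ℕ} (m n : Fin L → ℂ) :
    symbolMatrix m * symbolMatrix n = symbolMatrix (fun j => m j * n j) := by
  simp only [symbolMatrix]
  rw [← Matrix.diagonal_mul_diagonal]
  calc _ = waveMatrix L * Matrix.diagonal m * (waveInv L * waveMatrix L) * Matrix.diagonal n
        * waveInv L := by simp only [Matrix.mul_assoc]
    _ = _ := by rw [waveInv_mul_waveMatrix]; simp only [Matrix.mul_assoc, Matrix.one_mul]

lemma symbolMatrix_add {L : ℕ} (m n : Fin L → ℂ) :
    symbolMatrix m + symbolMatrix n = symbolMatrix (fun j => m j + n j) := by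
  simp only [symbolMatrix]
  rw [← Matrix.diagonal_add, Matrix.mul_add, Matrix.add_mul]

lemma smul_symbolMatrix {L : ℕ} (a : ℂ) (m : Fin L → ℂ) :
    a • symbolMatrix m = symbolMatrix (fun j => a * m j) := by
  simp only [symbolMatrix]
  have : Matrix.diagonal (fun j => a * m j) = a • Matrix.diagonal m := by
    rw [← Matrix.diagonal_smul]; rfl
  rw [this, Matrix.mul_smul, Matrix.smul_mul]

lemma neg_symbolMatrix {L : ℕ} (m : Fin L → ℂ) :
    -symbolMatrix m = symbolMatrix (fun j => -m j) := by
  have := smul_symbolMatrix (-1) m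
  simpa using this

lemma symbolMatrix_apply {L : ℕ} (m : Fin L → ℂ) (x y : Fin L) :
    symbolMatrix m x y =
      ∑ j, phase L j ^ (x : ℕ) * m j * ((L : ℂ)⁻¹ * ((phase L j)⁻¹) ^ (y : ℕ)) := by
  rw [symbolMatrix, Matrix.mul_apply]
  simp only [Matrix.mul_diagonal, waveMatrix, waveInv]

/-- Transposition reverses momentum, and `Fin.rev` realises q ↦ 2π - q. Symmetric and antisymmetric
matrices thus correspond to even and odd symbols. -/
lemma symbolMatrix_transpose {L : ℕ} (m : Fin L → ℂ) :
    (symbolMatrix m).transpose = symbolMatrix (fun j => m (Fin.rev j)) := by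
  ext x y
  rw [Matrix.transpose_apply, symbolMatrix_apply, symbolMatrix_apply, ← Equiv.sum_comp Fin.revPerm]
  refine Finset.sum_congr rfl fun j _ => ?_
  rw [Fin.revPerm_apply, phase_rev, inv_inv]
  ring

lemma shiftMatrix_eq (L : ℕ) : shiftMatrix L = symbolMatrix (phase L) := by
  have h1 : shiftMatrix L * waveMatrix L = waveMatrix L * Matrix.diagonal (phase L) := by
    ext x j
    rw [shiftMatrix_mul_apply, Matrix.mul_diagonal]
    simp only [waveMatrix, bondSign, next]
    split_ifs with h
    · rw [Nat.mod_eq_of_lt h, pow_succ, one_mul]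
    · have hx : (x : ℕ) + 1 = L := by have := x.isLt; omega
      rw [hx, Nat.mod_self, ← pow_succ, hx, phase_pow_card, pow_zero, mul_one]
  rw [symbolMatrix, ← h1, Matrix.mul_assoc, waveMatrix_mul_waveInv, Matrix.mul_one]

lemma trace_symbolMatrix {L : ℕ} (m : Fin L → ℂ) : (symbolMatrix m).trace = ∑ j, m j := by
  rw [symbolMatrix, Matrix.trace_mul_comm, ← Matrix.mul_assoc, waveInv_mul_waveMatrix,
    Matrix.one_mul, Matrix.trace_diagonal]

lemma sum_cos_momentum {L : ℕ} (hL : 2 ≤ L) : ∑ j : Fin L, Real.cos (momentum L j) = 0 := by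
  have h1 := trace_symbolMatrix (phase L)
  rw [← shiftMatrix_eq] at h1
  have h2 : (shiftMatrix L).trace = 0 :=
    Finset.sum_eq_zero fun k _ => by
      simp [shiftMatrix, (next_ne hL k).symm]
  rw [h2] at h1
  have h3 := congrArg Complex.re h1
  simp only [phase_eq, Complex.re_sum] at h3
  simpa [← Complex.ofReal_cos, ← Complex.ofReal_sin] using h3.symm

/-! ### One-particle energies and the leading eigenvector -/

/-- The squared one-particle energy. -/
def energySq (μ z q : ℝ) : ℝ :=
  ((2 * μ + z) * Real.cos q - 1) ^ 2 + 4 * μ * (μ + z) * Real.sin q ^ 2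

/-- The pairing amplitude. -/
def pairing (μ z q : ℝ) : ℝ :=
  ((2 * μ + z) * Real.cos q - 1 + √(energySq μ z q)) / (2 * μ * Real.sin q)

lemma energySq_nonneg {μ z : ℝ} (hμ : 0 ≤ μ) (hz : 0 ≤ z) (q : ℝ) : 0 ≤ energySq μ z q := by
  unfold energySq; positivity

lemma pairing_riccati {μ z : ℝ} (hμ : 0 < μ) (hz : 0 ≤ z) (q : ℝ) :
    μ * Real.sin q * pairing μ z q ^ 2 - ((2 * μ + z) * Real.cos q - 1) * pairing μ z q
      - (μ + z) * Real.sin q = 0 := by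
  by_cases hs : Real.sin q = 0
  · simp [pairing, hs]
  · have h1 : pairing μ z q * (2 * μ * Real.sin q) =
        (2 * μ + z) * Real.cos q - 1 + √(energySq μ z q) :=
      div_mul_cancel₀ _ (by positivity)
    have h2 : √(energySq μ z q) ^ 2 =
        ((2 * μ + z) * Real.cos q - 1) ^ 2 + 4 * μ * (μ + z) * Real.sin q ^ 2 :=
      Real.sq_sqrt (energySq_nonneg hμ.le hz q)
    set κ := pairing μ z q
    set r := √(energySq μ z q)
    have h3 : (4 * μ * Real.sin q) * (μ * Real.sin q * κ ^ 2 - ((2 * μ + z) * Real.cos q - 1) * κ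
      - (μ + z) * Real.sin q) = 0 := by
      linear_combination (κ * (2 * μ * Real.sin q) - ((2 * μ + z) * Real.cos q - 1) + r) * h1 + h2
    exact (mul_eq_zero.1 h3).resolve_left (by positivity)

/-- The denominator of `pairing` vanishes at q = π, a momentum that occurs for odd L; there division
by zero gives 0, and the right side is 0 too because the square root equals 2μ + z + 1. At q = 0
this could fail, but antiperiodic momenta exclude it. -/
lemma sin_mul_pairing {μ z : ℝ} (hμ : 0 < μ) (hz : 0 ≤ z) {L j : ℕ} (hj : j < L) :
    2 * (μ * Real.sin (momentum L j) * pairing μ z (momentum L j)) =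
      (2 * μ + z) * Real.cos (momentum L j) - 1 + √(energySq μ z (momentum L j)) := by
  have h0 := momentum_pos hj
  have h1 := momentum_lt hj
  generalize momentum L j = q at *
  by_cases hs : Real.sin q = 0
  · have h2 : Real.cos q ≠ 1 := fun h => by
      rw [Real.cos_eq_one_iff_of_lt_of_lt (by linarith) h1] at h
      linarith
    have h3 : Real.cos q = -1 := by
      have : (Real.cos q - 1) * (Real.cos q + 1) = 0 := by
        have := Real.sin_sq_add_cos_sq q
        rw [hs] at this
        linear_combination this
      rcases mul_eq_zero.1 this with h | h
      · exact absurd (sub_eq_zero.1 h) h2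
      · linarith
    have h4 : energySq μ z q = (2 * μ + z + 1) ^ 2 := by rw [energySq, hs, h3]; ring
    rw [h4, Real.sqrt_sq (by positivity), hs, h3]
    ring
  · rw [pairing]
    field_simp

lemma pairing_rev {μ z : ℝ} {L : ℕ} (j : Fin L) :
    pairing μ z (momentum L (Fin.rev j)) = -pairing μ z (momentum L j) := by
  rw [pairing, pairing, energySq, energySq, cos_momentum_rev, sin_momentum_rev, neg_sq, mul_neg,
    div_neg]

/-- The largest eigenvalue of the tilted generator in the even sector. -/
def topEigenvalue (μ z : ℝ) (L : ℕ) : ℝ :=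
  -(L * (μ + 1 / 2)) + 1 / 2 * ∑ j : Fin L, √(energySq μ z (momentum L j))

/-- The pairing matrix of the leading eigenvector. -/
def pairMatrix (μ z : ℝ) (L : ℕ) : Matrix (Fin L) (Fin L) ℂ :=
  symbolMatrix fun j => Complex.I * pairing μ z (momentum L j)

lemma pairMatrix_transpose (μ z : ℝ) (L : ℕ) :
    (pairMatrix μ z L).transpose = -pairMatrix μ z L := by
  simp only [pairMatrix, symbolMatrix_transpose, neg_symbolMatrix, pairing_rev]
  congr 1
  funext j
  push_cast
  ring

lemma trace_shiftMatrix_mul_pairMatrix {μ z : ℝ} (hμ : 0 < μ) (hz : 0 ≤ z) {L : ℕ} (hL : 2 ≤ L) :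
    -(L * (μ : ℂ)) - μ * (shiftMatrix L * pairMatrix μ z L).trace = (topEigenvalue μ z L : ℝ) := by
  have h1 : ∑ j : Fin L, Real.cos (momentum L j) * pairing μ z (momentum L j) = 0 := by
    have : ∑ j : Fin L, Real.cos (momentum L j) * pairing μ z (momentum L j) =
        -∑ j : Fin L, Real.cos (momentum L j) * pairing μ z (momentum L j) := by
      conv_lhs => rw [← Equiv.sum_comp Fin.revPerm]
      simp only [Fin.revPerm_apply, cos_momentum_rev, pairing_rev, mul_neg, Finset.sum_neg_distrib]
    linarith
  have h2 : 2 * ∑ j : Fin L, (μ * Real.sin (momentum L j) * pairing μ z (momentum L j)) =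
      -L + ∑ j : Fin L, √(energySq μ z (momentum L j)) := by
    rw [Finset.mul_sum, Finset.sum_congr rfl fun j _ => sin_mul_pairing hμ hz j.isLt,
      Finset.sum_add_distrib, Finset.sum_sub_distrib, ← Finset.mul_sum, sum_cos_momentum hL]
    simp
  have h3 : topEigenvalue μ z L =
      -(L * μ) + ∑ j : Fin L, (μ * Real.sin (momentum L j) * pairing μ z (momentum L j)) := by
    rw [topEigenvalue]
    linear_combination -(1 / 2) * h2
  rw [shiftMatrix_eq, pairMatrix, symbolMatrix_mul, trace_symbolMatrix, h3]
  have h4 : ∀ j : Fin L, phase L j * (Complex.I * pairing μ z (momentum L j)) =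
      Complex.I * ((Real.cos (momentum L j) * pairing μ z (momentum L j) : ℝ) : ℂ)
        - ((Real.sin (momentum L j) * pairing μ z (momentum L j) : ℝ) : ℂ) := by
    intro j
    rw [phase_eq, Complex.ofReal_mul, Complex.ofReal_mul]
    linear_combination (Real.sin (momentum L j) * pairing μ z (momentum L j) : ℂ) * Complex.I_sq
  rw [Finset.sum_congr rfl fun j _ => h4 j, Finset.sum_sub_distrib, ← Finset.mul_sum,
    ← Complex.ofReal_sum, h1]
  simp only [mul_assoc, ← Finset.mul_sum]
  push_cast
  ring

/-- The leading eigenvector of the tilted generator, with complex entries. -/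
def leadingState (μ z : ℝ) (L : ℕ) : Config L → ℂ :=
  gaussState creat (Pi.single (fun _ => false) 1) (pairMatrix μ z L)

lemma fermiForm_leadingState {μ z : ℝ} (hμ : 0 < μ) (hz : 0 ≤ z) {L : ℕ} (hL : 2 ≤ L) :
    fermiForm annih creat (μ : ℂ) z (leadingState μ z L) =
      ((topEigenvalue μ z L : ℝ) : ℂ) • leadingState μ z L := by
  rw [← trace_shiftMatrix_mul_pairMatrix hμ hz hL]
  refine (isFock_siteOp L).fermiForm_gaussState μ z (pairMatrix_transpose μ z L) rfl ?_
  -- The symmetry of `M` says that its symbol is even in q; the odd part of the symbol is a multiple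
  -- of the Riccati expression.
  simp only [shiftMatrix_eq, pairMatrix, symbolMatrix_mul, symbolMatrix_add, symbolMatrix_transpose,
    smul_symbolMatrix, neg_symbolMatrix]
  congr 1
  funext j
  simp only [phase_rev, pairing_rev, Fin.rev_rev]
  have hr : (μ * Real.sin (momentum L j) * pairing μ z (momentum L j) ^ 2
      - ((2 * μ + z) * Real.cos (momentum L j) - 1) * pairing μ z (momentum L j)
      - (μ + z) * Real.sin (momentum L j) : ℂ) = 0 := by
    exact_mod_cast pairing_riccati hμ hz (momentum L j)
  rw [phase_inv, phase_eq, Complex.ofReal_neg]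
  linear_combination (2 * Complex.I) * hr - (2 * μ * Real.sin (momentum L j) *
    pairing μ z (momentum L j) ^ 2 * Complex.I) * Complex.I_sq

/-- The leading eigenvector of the tilted generator. -/
def leadingVector (μ z : ℝ) (L : ℕ) (η : Config L) : ℝ := (leadingState μ z L η).re

lemma tilted_leadingVector {μ z : ℝ} (hμ : 0 < μ) (hz : 0 ≤ z) {L : ℕ} (hL : 2 ≤ L) {η : Config L}
    (h : Even (numParticles η)) :
    tilted μ z (leadingVector μ z L) η = topEigenvalue μ z L * leadingVector μ z L η := by
  have h1 := fermiForm_apply_of_even hL μ z (leadingState μ z L) h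
  rw [fermiForm_leadingState hμ hz hL, Pi.smul_apply, smul_eq_mul] at h1
  -- The real part is again an eigenvector because the tilted generator and the eigenvalue are real,
  -- so the reality of the Gaussian state need not be shown.
  have h2 := congrArg Complex.re h1
  simp only [Complex.re_sum, Complex.sub_re, Complex.re_ofReal_mul] at h2
  exact h2.symm

lemma leadingVector_empty (μ z : ℝ) (L : ℕ) : leadingVector μ z L (fun _ => false) = 1 := by
  have h := apply_gaussState (d := creat) (v := Pi.single (fun _ => false) 1)
    (φ := (ContinuousLinearMap.proj (R := ℂ) (φ := fun _ : Config L => ℂ) (fun _ => false)))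
    (fun k x => by simp [creat]) (pairMatrix μ z L)
  have h1 : leadingState μ z L (fun _ => false) = 1 := by
    rw [leadingState]
    simpa using h
  rw [leadingVector, h1, Complex.one_re]

lemma continuous_leadingVector (μ : ℝ) (L : ℕ) (η : Config L) :
    Continuous fun z => leadingVector μ z L η := by
  have h1 : Continuous fun z => leadingState μ z L := by
    refine continuous_gaussState fun x y => ?_
    simp only [pairMatrix, symbolMatrix_apply, pairing, energySq]
    fun_prop
  exact Complex.continuous_re.comp ((continuous_apply η).comp h1)

/-! ### Connectedness of the even sector and positivity -/

lemma even_numParticles_iff {L : ℕ} (η : Config L) :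
    Even (numParticles η) ↔ ∏ j, occSign (η j) = 1 := by
  rw [prod_occSign, neg_one_pow_eq_one_iff_even (by norm_num)]

lemma prod_occSign_flipSite {L : ℕ} (k : Fin L) (η : Config L) :
    ∏ j, occSign (flipSite k η j) = -∏ j, occSign (η j) := by
  rw [← Finset.mul_prod_erase _ _ (Finset.mem_univ k), flipSite_same, occSign_not, neg_mul,
    ← Finset.mul_prod_erase _ (fun j => occSign (η j)) (Finset.mem_univ k)]
  congr 2
  refine Finset.prod_congr rfl fun i hi => ?_
  rw [flipSite_ne (Finset.ne_of_mem_erase hi)]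

lemma even_flipBond {L : ℕ} (hL : 2 ≤ L) (k : Fin L) {η : Config L} (h : Even (numParticles η)) :
    Even (numParticles (flipBond k η)) := by
  rw [even_numParticles_iff] at h ⊢
  rw [← flipSite_flipSite_next hL, prod_occSign_flipSite, prod_occSign_flipSite, neg_neg, h]

lemma flipBond_flipBond {L : ℕ} (k : Fin L) (η : Config L) :
    flipBond k (flipBond k η) = η := by
  funext j
  by_cases h : j = k ∨ j = next k <;> simp [flipBond, h]

/-- Sweep from left to right: if site m is occupied, flipping the bond (m, m + 1) empties it without
touching earlier sites. Only the last site can survive the sweep, and parity forces it to be empty.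
-/
lemma of_flipBond_closed_empty {L : ℕ} (hL : 2 ≤ L) {p : Config L → Prop}
    (hp : ∀ k η, Even (numParticles η) → p η → p (flipBond k η)) {η : Config L}
    (h : Even (numParticles η)) (h0 : p η) : p fun _ => false := by
  have key : ∀ m : ℕ, m < L → ∃ ζ : Config L, Even (numParticles ζ) ∧ p ζ ∧
      ∀ j : Fin L, j.val < m → ζ j = false := by
    intro m
    induction m with
    | zero => exact fun _ => ⟨η, h, h0, fun j hj => absurd hj (Nat.not_lt_zero _)⟩
    | succ m ih =>
      intro hm
      obtain ⟨ζ, hζ, hpζ, hz⟩ := ih (by omega)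
      let k : Fin L := ⟨m, by omega⟩
      have hv : (next k).val = m + 1 := by simp [next, k, Nat.mod_eq_of_lt hm]
      cases hk : ζ k
      · refine ⟨ζ, hζ, hpζ, fun j hj => ?_⟩
        rcases Nat.lt_succ_iff_lt_or_eq.1 hj with hj | hj
        · exact hz j hj
        · rw [show j = k from Fin.ext hj, hk]
      · refine ⟨flipBond k ζ, even_flipBond hL k hζ, hp k ζ hζ hpζ, fun j hj => ?_⟩
        rcases Nat.lt_succ_iff_lt_or_eq.1 hj with hj | hj
        · have h1 : j ≠ k := fun h => by rw [h] at hj; exact lt_irrefl _ hj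
          have h2 : j ≠ next k := fun h => by rw [h, hv] at hj; omega
          simp [flipBond, h1, h2, hz j hj]
        · rw [show j = k from Fin.ext hj]
          simp [flipBond, hk]
  obtain ⟨ζ, hζ, hpζ, hz⟩ := key (L - 1) (by omega)
  convert hpζ with j
  let k : Fin L := ⟨L - 1, by omega⟩
  by_cases hj : j = k
  · rw [even_numParticles_iff, Finset.prod_eq_single k] at hζ
    · rw [hj]
      cases hk : ζ k
      · rfl
      · rw [hk] at hζ
        norm_num [occSign] at hζ
    · intro i _ hi
      have : i.val < L - 1 := by
        have h1 := i.isLt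
        have h2 : i.val ≠ L - 1 := fun h => hi (Fin.ext h)
        omega
      rw [hz i this]; rfl
    · exact fun h => absurd (Finset.mem_univ _) h
  · have h1 := j.isLt
    have h2 : j.val ≠ L - 1 := fun h => hj (Fin.ext h)
    exact (hz j (by omega)).symm

lemma of_flipBond_closed {L : ℕ} (hL : 2 ≤ L) {p : Config L → Prop}
    (hp : ∀ k η, Even (numParticles η) → p η → p (flipBond k η)) {η ζ : Config L}
    (hη : Even (numParticles η)) (hζ : Even (numParticles ζ)) (h0 : p η) : p ζ := by
  have h1 := of_flipBond_closed_empty hL hp hη h0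
  by_contra h2
  -- Bond flips are involutions, so the complement of a closed property is closed too; a failure at
  -- `ζ` would propagate to the empty configuration.
  refine of_flipBond_closed_empty hL (p := fun η => ¬ p η) (fun k η hη h3 h4 => h3 ?_) hζ h2 h1
  have := hp k _ (even_flipBond hL k hη) h4
  rwa [flipBond_flipBond] at this

lemma occ_nonneg {L : ℕ} (η : Config L) (k : Fin L) : 0 ≤ occ η k := by
  unfold occ; split_ifs <;> norm_num

lemma occ_le_one {L : ℕ} (η : Config L) (k : Fin L) : occ η k ≤ 1 := by
  unfold occ; split_ifs <;> norm_num

lemma rate_pos {μ z : ℝ} (hμ : 0 < μ) (hz : 0 ≤ z) {L : ℕ} (η : Config L) (k : Fin L) :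
    0 < μ + z / 2 * (occ η k + occ η (next k)) := by
  have := occ_nonneg η k
  have := occ_nonneg η (next k)
  positivity

/-- At a zero of `φ` the eigenvalue equation says that a sum of nonnegative terms with positive
rates vanishes, so every neighbour is a zero as well; connectedness does the rest. -/
lemma eq_zero_of_tilted_eq {μ z lam : ℝ} (hμ : 0 < μ) (hz : 0 ≤ z) {L : ℕ} (hL : 2 ≤ L)
    {φ : Config L → ℝ} (hφ : ∀ η, Even (numParticles η) → 0 ≤ φ η)
    (heq : ∀ η, Even (numParticles η) → tilted μ z φ η = lam * φ η) {η ζ : Config L}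
    (hη : Even (numParticles η)) (hζ : Even (numParticles ζ)) (h0 : φ η = 0) : φ ζ = 0 := by
  refine of_flipBond_closed hL (p := fun η => φ η = 0) (fun k η hη h => ?_) hη hζ h0
  have h1 := heq η hη
  simp only [tilted, h, mul_zero, sub_zero] at h1
  have h2 := (Finset.sum_eq_zero_iff_of_nonneg fun k _ =>
    mul_nonneg (rate_pos hμ hz η k).le (hφ _ (even_flipBond hL k hη))).1 h1 k (Finset.mem_univ k)
  exact (mul_eq_zero.1 h2).resolve_left (rate_pos hμ hz η k).ne'

lemma even_empty (L : ℕ) : Even (numParticles (fun _ : Fin L => false)) := by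
  simp [numParticles]

lemma topEigenvalue_one {μ : ℝ} (hμ : 0 < μ) {L : ℕ} (hL : 2 ≤ L) : topEigenvalue μ 1 L = 0 := by
  have h1 : ∀ j : Fin L, √(energySq μ 1 (momentum L j)) =
      1 + 2 * μ - Real.cos (momentum L j) := by
    intro j
    have : energySq μ 1 (momentum L j) = (1 + 2 * μ - Real.cos (momentum L j)) ^ 2 := by
      rw [energySq]
      linear_combination (4 * μ * (μ + 1)) * Real.sin_sq_add_cos_sq (momentum L j)
    rw [this, Real.sqrt_sq]
    linarith [Real.cos_le_one (momentum L j)]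
  rw [topEigenvalue, Finset.sum_congr rfl fun j _ => h1 j, Finset.sum_sub_distrib,
    sum_cos_momentum hL]
  simp
  ring

lemma leadingVector_one {μ : ℝ} (hμ : 0 < μ) {L : ℕ} (hL : 2 ≤ L) {η : Config L}
    (h : Even (numParticles η)) : leadingVector μ 1 L η = 1 := by
  obtain ⟨ζ, hζ, hmax⟩ := (Finset.univ.filter fun η : Config L => Even (numParticles η)).exists_max_image
    (leadingVector μ 1 L) ⟨_, by simpa using even_empty L⟩
  simp only [Finset.mem_filter, Finset.mem_univ, true_and] at hζ hmax
  have h1 : ∀ η, Even (numParticles η) → leadingVector μ 1 L ζ - leadingVector μ 1 L η = 0 := by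
    intro η hη
    -- Maximum principle: at z = 1 the operator is a Markov generator and kills constants, so the
    -- gap below the maximum is a nonnegative harmonic function with a zero.
    refine eq_zero_of_tilted_eq hμ zero_le_one hL (lam := 0)
      (φ := fun η => leadingVector μ 1 L ζ - leadingVector μ 1 L η)
      (fun η hη => sub_nonneg.2 (hmax η hη)) (fun η hη => ?_) hζ hη (sub_self _)
    have h2 := tilted_leadingVector hμ zero_le_one hL hη
    rw [topEigenvalue_one hμ hL, zero_mul] at h2
    rw [zero_mul, ← neg_zero, ← h2, tilted, tilted, ← Finset.sum_neg_distrib]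
    exact Finset.sum_congr rfl fun k _ => by ring
  have h2 := h1 _ h
  have h3 := h1 _ (even_empty L)
  rw [leadingVector_empty] at h3
  linarith

/-- Continuity argument in s. The set of s with a positive vector is open, as there are finitely
many configurations; it is closed, since a nonnegative limit with a zero would vanish everywhere
although its value at the empty configuration is 1; and it contains s = 0, where the vector is
constant. -/
lemma leadingVector_pos {μ : ℝ} (hμ : 0 < μ) {L : ℕ} (hL : 2 ≤ L) (s : ℝ) {η : Config L}
    (h : Even (numParticles η)) : 0 < leadingVector μ (Real.exp s) L η := by
  have hcont : ∀ η : Config L, Continuous fun s => leadingVector μ (Real.exp s) L η := fun η =>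
    (continuous_leadingVector μ L η).comp Real.continuous_exp
  set A : Set ℝ := {s | ∀ η : Config L, Even (numParticles η) →
    0 < leadingVector μ (Real.exp s) L η} with hA
  have hA' : A = {s | ∀ η : Config L, Even (numParticles η) →
      0 ≤ leadingVector μ (Real.exp s) L η} := by
    ext s
    refine ⟨fun h η hη => (h η hη).le, fun h η hη => (h η hη).lt_of_ne' fun h0 => ?_⟩
    have := eq_zero_of_tilted_eq hμ (Real.exp_pos s).le hL h
      (fun η hη => tilted_leadingVector hμ (Real.exp_pos s).le hL hη) hη (even_empty L) h0
    rw [leadingVector_empty] at this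
    exact one_ne_zero this
  have hclosed : IsClosed A := by
    rw [hA']
    simp only [Set.ofPred_forall]
    exact isClosed_iInter fun η => isClosed_iInter fun _ => isClosed_le continuous_const (hcont η)
  have hopen : IsOpen A := by
    rw [hA]
    simp only [Set.ofPred_forall]
    exact isOpen_iInter_of_finite fun η => isOpen_iInter_of_finite fun _ =>
      isOpen_lt continuous_const (hcont η)
  have huniv : A = Set.univ := IsClopen.eq_univ ⟨hclosed, hopen⟩
    ⟨0, fun η hη => by rw [Real.exp_zero, leadingVector_one hμ hL hη]; exact one_pos⟩
  have : s ∈ A := huniv ▸ Set.mem_univ s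
  exact this η h

/-! ### From the joint semigroup to the tilted semigroup -/

section Exponential

variable {E : Type*} [NormedAddCommGroup E] [NormedSpace ℝ E] [CompleteSpace E]

lemma hasSum_apply_exp (T : E →L[ℝ] E) (φ : E →L[ℝ] ℝ) (v : E) (t : ℝ) :
    HasSum (fun n : ℕ => t ^ n / n.factorial * φ ((T ^ n) v)) (φ (NormedSpace.exp (t • T) v)) := by
  have h0 := NormedSpace.exp_series_hasSum_exp' (𝕂 := ℝ) (t • T)
  have h1 := h0.mapL (φ.comp (ContinuousLinearMap.apply ℝ E v))
  refine (congrArg (HasSum · _) (funext fun n => ?_)).mpr h1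
  simp [smul_pow]
  ring

lemma exp_smul_eq (T : E →L[ℝ] E) (γ t : ℝ) :
    NormedSpace.exp (t • T) = Real.exp (-(γ * t)) • NormedSpace.exp (t • (T + γ • 1)) := by
  let _ : NormedAlgebra ℚ (E →L[ℝ] E) := NormedAlgebra.restrictScalars ℚ ℝ _
  have h1 : t • T = algebraMap ℝ (E →L[ℝ] E) (-(γ * t)) + t • (T + γ • 1) := by
    rw [Algebra.algebraMap_eq_smul_one]
    module
  rw [h1, NormedSpace.exp_add_of_commute (Algebra.commutes _ _), ← NormedSpace.algebraMap_exp_comm,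
    ← Real.exp_eq_exp_ℝ]
  exact (Algebra.smul_def _ _).symm

/-- Adding `γ` to the operator only rescales the exponential by a positive factor; a generator
thereby becomes an operator with nonnegative entries, whose series is nonnegative term by term. -/
lemma apply_exp_nonneg {T : E →L[ℝ] E} {φ : E →L[ℝ] ℝ} {v : E} {γ t : ℝ} (ht : 0 ≤ t)
    (h : ∀ n : ℕ, 0 ≤ φ (((T + γ • 1) ^ n) v)) : 0 ≤ φ (NormedSpace.exp (t • T) v) := by
  rw [exp_smul_eq T γ, smul_apply, map_smul, smul_eq_mul]
  refine mul_nonneg (Real.exp_pos _).le ((hasSum_apply_exp _ φ v t).nonneg fun n => ?_)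
  exact mul_nonneg (by positivity) (h n)

lemma apply_exp_eq {T : E →L[ℝ] E} {φ : E →L[ℝ] ℝ} {v : E} {lam : ℝ} (t : ℝ)
    (h : ∀ n : ℕ, φ ((T ^ n) v) = lam ^ n * φ v) :
    φ (NormedSpace.exp (t • T) v) = Real.exp (lam * t) * φ v := by
  refine (hasSum_apply_exp T φ v t).unique ?_
  have h1 := (NormedSpace.exp_series_hasSum_exp' (𝕂 := ℝ) (lam * t)).mul_right (φ v)
  rw [← Real.exp_eq_exp_ℝ] at h1
  refine (congrArg (HasSum · _) (funext fun n => ?_)).mpr h1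
  rw [h, smul_eq_mul, mul_pow]
  ring

end Exponential

/-- The tilted generator as a bounded operator. -/
def tiltedOp (μ z : ℝ) (L : ℕ) : (Config L → ℝ) →L[ℝ] (Config L → ℝ) :=
  LinearMap.toContinuousLinearMap
    { toFun := tilted μ z
      map_add' := fun f g => by
        funext η
        simp only [tilted, Pi.add_apply, ← Finset.sum_add_distrib]
        exact Finset.sum_congr rfl fun k _ => by ring
      map_smul' := fun r f => by
        funext η
        simp only [tilted, Pi.smul_apply, smul_eq_mul, RingHom.id_apply, Finset.mul_sum]
        exact Finset.sum_congr rfl fun k _ => by ring }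

lemma tiltedOp_apply (μ z : ℝ) {L : ℕ} (f : Config L → ℝ) : tiltedOp μ z L f = tilted μ z f := rfl

lemma generator_mul_exp (μ s : ℝ) {L : ℕ} (g : Config L → ℝ) :
    generator (1 / 2) μ L (fun x => Real.exp (s * x.2) * g x.1) =
      fun x => Real.exp (s * x.2) * tilted μ (Real.exp s) g x.1 := by
  funext x
  simp only [generator, LinearMap.coe_mk, AddHom.coe_mk, tilted, Finset.mul_sum]
  refine Finset.sum_congr rfl fun k _ => ?_
  have : Real.exp (s * ((x.2 + 1 : ℕ) : ℝ)) = Real.exp (s * x.2) * Real.exp s := by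
    rw [← Real.exp_add]; push_cast; ring_nf
  rw [this]
  ring

lemma generator_pow_exp (μ s : ℝ) {L : ℕ} (n : ℕ) :
    ((generator (1 / 2) μ L) ^ n) (fun x => Real.exp (s * x.2)) =
      fun x => Real.exp (s * x.2) * ((tiltedOp μ (Real.exp s) L) ^ n) (fun _ => 1) x.1 := by
  induction n with
  | zero => simp
  | succ n ih =>
    rw [pow_succ', Module.End.mul_apply, ih, generator_mul_exp, pow_succ', mul_apply_eq_comp,
      tiltedOp_apply]

/-- The indicator function of activity `a`. -/
def actInd (L a : ℕ) : State L → ℝ := fun x => if x.2 = a then 1 else 0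

lemma hasSum_generator_pow (μ s : ℝ) {L : ℕ} (n : ℕ) (x : State L) :
    HasSum (fun a : ℕ => ((generator (1 / 2) μ L) ^ n) (actInd L a) x * Real.exp (s * a))
      (((generator (1 / 2) μ L) ^ n) (fun x => Real.exp (s * x.2)) x) := by
  induction n generalizing x with
  | zero =>
    convert hasSum_single x.2 fun a ha => ?_ using 1
    · simp [actInd]
    · simp [actInd, ha.symm]
  | succ n ih =>
    simp only [pow_succ', Module.End.mul_apply]
    generalize (generator (1 / 2) μ L) ^ n = g at ih
    simp only [generator, LinearMap.coe_mk, AddHom.coe_mk, Finset.sum_mul]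
    refine hasSum_sum fun k _ => ?_
    have h := ((((ih (flipBond k x.1, x.2)).mul_left μ)).add
      ((ih (flipBond k x.1, x.2 + 1)).mul_left (1 / 2 * (occ x.1 k + occ x.1 (next k))))).sub
      ((ih x).mul_left (μ + 1 / 2 * (occ x.1 k + occ x.1 (next k))))
    refine (congrArg (HasSum · _) (funext fun a => ?_)).mpr h
    ring

lemma abs_combination_le {m c d : ℝ} (A B D e : ℝ) (hm : 0 ≤ m) (hc : 0 ≤ c) (hc1 : c ≤ 1)
    (hd : 0 ≤ d) (hd1 : d ≤ m + 1) :
    |(m * A + c * B - d * D) * e| ≤ m * |A * e| + 1 * |B * e| + (m + 1) * |D * e| := by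
  have h1 : (m * A + c * B - d * D) * e = m * (A * e) + c * (B * e) - d * (D * e) := by ring
  rw [h1]
  refine (abs_sub _ _).trans (add_le_add ((abs_add_le _ _).trans (add_le_add ?_ ?_)) ?_)
  · rw [abs_mul, abs_of_nonneg hm]
  · rw [abs_mul, abs_of_nonneg hc]
    exact mul_le_mul_of_nonneg_right hc1 (abs_nonneg _)
  · rw [abs_mul, abs_of_nonneg hd]
    exact mul_le_mul_of_nonneg_right hd1 (abs_nonneg _)

/-- The base of the power collects, per bond, weight μ for deposition, at most 1 for a jump, which
also contributes e^s, and at most μ + 1 for the exit term. The bound is uniform in `F`, hence gives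
summability over the activity. -/
lemma sum_abs_generator_pow_le {μ : ℝ} (hμ : 0 ≤ μ) (s : ℝ) {L : ℕ} (n : ℕ) (F : Finset ℕ)
    (x : State L) :
    ∑ a ∈ F, |((generator (1 / 2) μ L) ^ n) (actInd L a) x * Real.exp (s * a)| ≤
      (L * (2 * μ + Real.exp s + 1)) ^ n * Real.exp (s * x.2) := by
  induction n generalizing x with
  | zero =>
    have h : ∀ a : ℕ, |((generator (1 / 2) μ L) ^ 0) (actInd L a) x * Real.exp (s * a)| =
        if a = x.2 then Real.exp (s * x.2) else 0 := by
      intro a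
      by_cases h : a = x.2
      · simp [actInd, h]
      · simp [actInd, h, Ne.symm h]
    rw [Finset.sum_congr rfl fun a _ => h a, Finset.sum_ite_eq', pow_zero, one_mul]
    split_ifs
    · exact le_rfl
    · exact (Real.exp_pos _).le
  | succ n ih =>
    simp only [pow_succ' (generator (1 / 2) μ L), Module.End.mul_apply]
    generalize (generator (1 / 2) μ L) ^ n = g at ih
    set B := (L * (2 * μ + Real.exp s + 1)) ^ n with hB
    have hB0 : 0 ≤ B := by positivity
    have hterm : ∀ a : ℕ, |generator (1 / 2) μ L (g (actInd L a)) x * Real.exp (s * a)| ≤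
        ∑ k : Fin L, (μ * |g (actInd L a) (flipBond k x.1, x.2) * Real.exp (s * a)|
          + 1 * |g (actInd L a) (flipBond k x.1, x.2 + 1) * Real.exp (s * a)|
          + (μ + 1) * |g (actInd L a) x * Real.exp (s * a)|) := by
      intro a
      simp only [generator, LinearMap.coe_mk, AddHom.coe_mk, Finset.sum_mul]
      refine (Finset.abs_sum_le_sum_abs _ _).trans (Finset.sum_le_sum fun k _ => ?_)
      have h1 := occ_nonneg x.1 k
      have h2 := occ_nonneg x.1 (next k)
      have h3 := occ_le_one x.1 k
      have h4 := occ_le_one x.1 (next k)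
      exact abs_combination_le _ _ _ _ hμ (by positivity) (by linarith) (by positivity)
        (by linarith)
    refine (Finset.sum_le_sum fun a _ => hterm a).trans ?_
    rw [Finset.sum_comm]
    have hk : ∀ k : Fin L, ∑ a ∈ F, (μ * |g (actInd L a) (flipBond k x.1, x.2) * Real.exp (s * a)|
          + 1 * |g (actInd L a) (flipBond k x.1, x.2 + 1) * Real.exp (s * a)|
          + (μ + 1) * |g (actInd L a) x * Real.exp (s * a)|) ≤
        (2 * μ + Real.exp s + 1) * (B * Real.exp (s * x.2)) := by
      intro k
      rw [Finset.sum_add_distrib, Finset.sum_add_distrib, ← Finset.mul_sum, ← Finset.mul_sum,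
        ← Finset.mul_sum]
      have e1 := mul_le_mul_of_nonneg_left (ih (flipBond k x.1, x.2)) hμ
      have e2 := ih (flipBond k x.1, x.2 + 1)
      have e3 := mul_le_mul_of_nonneg_left (ih x) (by positivity : 0 ≤ μ + 1)
      have e4 : Real.exp (s * ((x.2 + 1 : ℕ) : ℝ)) = Real.exp (s * x.2) * Real.exp s := by
        rw [← Real.exp_add]; push_cast; ring_nf
      simp only [e4] at e2
      calc _ ≤ _ := add_le_add (add_le_add e1 (mul_le_mul_of_nonneg_left e2 zero_le_one)) e3
        _ = _ := by ring
    refine (Finset.sum_le_sum fun k _ => hk k).trans (le_of_eq ?_)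
    rw [Finset.sum_const, Finset.card_univ, Fintype.card_fin, nsmul_eq_mul, pow_succ]
    ring

/-- The definition sums over the activity outside and over the exponential series inside. The bound
on generator powers makes the double series absolutely summable, so the sums may be exchanged; the
inner sum is then a power of the tilted generator. -/
lemma activityMGF_eq {μ : ℝ} (hμ : 0 ≤ μ) (s : ℝ) {L : ℕ} (η : Config L) (t : ℝ) :
    activityMGF (1 / 2) μ L η s t =
      NormedSpace.exp (t • tiltedOp μ (Real.exp s) L) (fun _ => 1) η := by
  set u : ℕ → ℕ → ℝ := fun n a =>
    ((generator (1 / 2) μ L) ^ n) (actInd L a) (η, 0) * Real.exp (s * a) with hu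
  have hbound : ∀ n (F : Finset ℕ), ∑ a ∈ F, |u n a| ≤ (L * (2 * μ + Real.exp s + 1)) ^ n := by
    intro n F
    have := sum_abs_generator_pow_le hμ s n F ((η, 0) : State L)
    simp only [Nat.cast_zero, mul_zero, Real.exp_zero, mul_one] at this
    exact this
  have hsum : ∀ n, Summable fun a => |u n a| := fun n =>
    summable_of_sum_le (fun _ => abs_nonneg _) (hbound n)
  have habs : Summable fun p : ℕ × ℕ => |t ^ p.1 / (p.1.factorial : ℝ) * u p.1 p.2| := by
    refine (summable_prod_of_nonneg fun _ => abs_nonneg _).2 ⟨fun n => ?_, ?_⟩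
    · simp only [abs_mul]
      exact (hsum n).mul_left _
    · simp only [abs_mul, tsum_mul_left]
      refine Summable.of_nonneg_of_le (fun n => mul_nonneg (abs_nonneg _)
        (tsum_nonneg fun _ => abs_nonneg _)) (fun n => ?_)
        (Real.summable_pow_div_factorial (|t| * (L * (2 * μ + Real.exp s + 1))))
      rw [abs_div, abs_pow, Nat.abs_cast, mul_pow, mul_div_right_comm]
      exact mul_le_mul_of_nonneg_left (Real.tsum_le_of_sum_le (fun _ => abs_nonneg _) (hbound n))
        (by positivity)
  have hprod : Summable fun p : ℕ × ℕ => t ^ p.1 / (p.1.factorial : ℝ) * u p.1 p.2 := habs.of_abs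
  have h1 : activityMGF (1 / 2) μ L η s t =
      ∑' a : ℕ, ∑' n : ℕ, t ^ n / (n.factorial : ℝ) * u n a := by
    rw [activityMGF]
    refine tsum_congr fun a => ?_
    rw [activityProb, semigroup, ← tsum_mul_right]
    exact tsum_congr fun n => mul_assoc _ _ _
  have h2 : ∀ n : ℕ, ∑' a : ℕ, t ^ n / (n.factorial : ℝ) * u n a =
      t ^ n / (n.factorial : ℝ) * ((tiltedOp μ (Real.exp s) L) ^ n) (fun _ => 1) η := by
    intro n
    rw [tsum_mul_left]
    congr 1
    have := hasSum_generator_pow μ s n ((η, 0) : State L)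
    rw [generator_pow_exp] at this
    simp only [Nat.cast_zero, mul_zero, Real.exp_zero, one_mul] at this
    exact this.tsum_eq
  rw [h1, hprod.tsum_comm, tsum_congr h2]
  exact (hasSum_apply_exp (tiltedOp μ (Real.exp s) L)
    (ContinuousLinearMap.proj (R := ℝ) (φ := fun _ : Config L => ℝ) η) (fun _ => 1) t).tsum_eq

/-! ### The long-time growth rate -/

lemma tilted_congr {μ z : ℝ} {L : ℕ} (hL : 2 ≤ L) {f g : Config L → ℝ}
    (h : ∀ η, Even (numParticles η) → f η = g η) {η : Config L} (hη : Even (numParticles η)) :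
    tilted μ z f η = tilted μ z g η := by
  unfold tilted
  refine Finset.sum_congr rfl fun k _ => ?_
  rw [h η hη, h _ (even_flipBond hL k hη)]

lemma tiltedOp_pow_leadingVector {μ z : ℝ} (hμ : 0 < μ) (hz : 0 ≤ z) {L : ℕ} (hL : 2 ≤ L) (n : ℕ)
    {η : Config L} (hη : Even (numParticles η)) :
    ((tiltedOp μ z L) ^ n) (leadingVector μ z L) η =
      topEigenvalue μ z L ^ n * leadingVector μ z L η := by
  induction n generalizing η with
  | zero => simp
  | succ n ih =>
    rw [pow_succ', mul_apply_eq_comp, tiltedOp_apply, tilted_congr hL (fun η hη => ih hη) hη]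
    have : (fun η => topEigenvalue μ z L ^ n * leadingVector μ z L η) =
        topEigenvalue μ z L ^ n • leadingVector μ z L := rfl
    rw [this, ← tiltedOp_apply, map_smul, Pi.smul_apply, tiltedOp_apply,
      tilted_leadingVector hμ hz hL hη, smul_eq_mul, pow_succ]
    ring

lemma shifted_tiltedOp_pow_nonneg {μ z : ℝ} (hμ : 0 < μ) (hz : 0 ≤ z) {L : ℕ} (hL : 2 ≤ L) (n : ℕ)
    {f : Config L → ℝ} (hf : ∀ η, Even (numParticles η) → 0 ≤ f η) {η : Config L}
    (hη : Even (numParticles η)) :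
    0 ≤ ((tiltedOp μ z L + (L * (μ + 1) : ℝ) • 1) ^ n) f η := by
  induction n generalizing η with
  | zero => simpa using hf η hη
  | succ n ih =>
    rw [pow_succ', mul_apply_eq_comp]
    generalize ((tiltedOp μ z L + (L * (μ + 1) : ℝ) • 1) ^ n) f = g at ih
    have h1 : (tiltedOp μ z L + (L * (μ + 1) : ℝ) • 1) g η =
        tilted μ z g η + ∑ _k : Fin L, (μ + 1) * g η := by
      simp [tiltedOp_apply, mul_assoc]
    rw [h1, tilted, ← Finset.sum_add_distrib]
    -- The shift L(μ + 1) gives each bond the amount μ + 1, the largest possible exit rate of a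
    -- bond.
    refine Finset.sum_nonneg fun k _ => ?_
    have h2 := mul_nonneg (rate_pos hμ hz η k).le (ih (even_flipBond hL k hη))
    have h3 : 0 ≤ (1 - 1 / 2 * (occ η k + occ η (next k))) * g η :=
      mul_nonneg (by linarith [occ_le_one η k, occ_le_one η (next k)]) (ih hη)
    linarith

lemma exp_tiltedOp_mono {μ z : ℝ} (hμ : 0 < μ) (hz : 0 ≤ z) {L : ℕ} (hL : 2 ≤ L) {t : ℝ}
    (ht : 0 ≤ t) {f g : Config L → ℝ} (hfg : ∀ η, Even (numParticles η) → f η ≤ g η) {η : Config L}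
    (hη : Even (numParticles η)) :
    NormedSpace.exp (t • tiltedOp μ z L) f η ≤ NormedSpace.exp (t • tiltedOp μ z L) g η := by
  have h1 := apply_exp_nonneg (T := tiltedOp μ z L) (v := g - f) (γ := L * (μ + 1))
    (φ := ContinuousLinearMap.proj (R := ℝ) (φ := fun _ : Config L => ℝ) η) ht
    fun n => shifted_tiltedOp_pow_nonneg hμ hz hL n
      (fun η hη => by simpa using hfg η hη) hη
  rw [map_sub] at h1
  simpa using h1

lemma exp_tiltedOp_leadingVector {μ z : ℝ} (hμ : 0 < μ) (hz : 0 ≤ z) {L : ℕ} (hL : 2 ≤ L) (t : ℝ)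
    {η : Config L} (hη : Even (numParticles η)) :
    NormedSpace.exp (t • tiltedOp μ z L) (leadingVector μ z L) η =
      Real.exp (topEigenvalue μ z L * t) * leadingVector μ z L η :=
  apply_exp_eq (T := tiltedOp μ z L) (v := leadingVector μ z L)
    (φ := ContinuousLinearMap.proj (R := ℝ) (φ := fun _ : Config L => ℝ) η) t
    fun n => tiltedOp_pow_leadingVector hμ hz hL n hη

lemma tendsto_add_mul_div (a b l : ℝ) :
    Tendsto (fun t : ℝ => (a + b * t) / (l * t)) atTop (𝓝 (b / l)) := by
  have h1 : Tendsto (fun t : ℝ => a / l * t⁻¹ + b / l) atTop (𝓝 (a / l * 0 + b / l)) :=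
    (tendsto_inv_atTop_zero.const_mul _).add_const _
  rw [mul_zero, zero_add] at h1
  refine h1.congr' ?_
  filter_upwards [eventually_gt_atTop 0] with t ht
  field_simp

/-- The even-sector cumulant generating function. -/
def cgf (μ : ℝ) (L : ℕ) (s : ℝ) : ℝ := topEigenvalue μ (Real.exp s) L / L

/-- The function 1 lies between ψ / max ψ and ψ / min ψ on the even sector. The semigroup preserves
this order and multiplies ψ by the exponential of the eigenvalue, so the logarithm is linear in t up
to a bounded error. -/
lemma isEvenCGF_cgf {μ : ℝ} (hμ : 0 < μ) {L : ℕ} (hL : 2 ≤ L) :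
    IsEvenCGF (1 / 2) μ L (cgf μ L) := by
  intro s η hη
  have hz := (Real.exp_pos s).le
  have hLpos : (0 : ℝ) < L := Nat.cast_pos.2 (by omega)
  have hne : (Finset.univ.filter fun η : Config L => Even (numParticles η)).Nonempty :=
    ⟨_, by simpa using even_empty L⟩
  set ψ := leadingVector μ (Real.exp s) L
  have hψ : ∀ η, Even (numParticles η) → 0 < ψ η := fun η hη => leadingVector_pos hμ hL s hη
  obtain ⟨ζ, hζ, hmin⟩ := Finset.exists_min_image _ ψ hne
  obtain ⟨ξ, hξ, hmax⟩ := Finset.exists_max_image _ ψ hne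
  simp only [Finset.mem_filter, Finset.mem_univ, true_and] at hζ hmin hξ hmax
  have hlow : ∀ t, 0 ≤ t → ((ψ ξ)⁻¹ * ψ η) * Real.exp (topEigenvalue μ (Real.exp s) L * t) ≤
      activityMGF (1 / 2) μ L η s t := by
    intro t ht
    rw [activityMGF_eq hμ.le]
    have h := exp_tiltedOp_mono hμ hz hL ht (f := (ψ ξ)⁻¹ • ψ) (g := fun _ => 1)
      (fun η hη => by
        rw [Pi.smul_apply, smul_eq_mul, inv_mul_le_one₀ (hψ ξ hξ)]
        exact hmax η hη) hη
    rw [map_smul, Pi.smul_apply, exp_tiltedOp_leadingVector hμ hz hL t hη, smul_eq_mul] at h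
    calc _ = _ := by ring
      _ ≤ _ := h
  have hupp : ∀ t, 0 ≤ t → activityMGF (1 / 2) μ L η s t ≤
      ((ψ ζ)⁻¹ * ψ η) * Real.exp (topEigenvalue μ (Real.exp s) L * t) := by
    intro t ht
    rw [activityMGF_eq hμ.le]
    have h := exp_tiltedOp_mono hμ hz hL ht (g := (ψ ζ)⁻¹ • ψ) (f := fun _ => 1)
      (fun η hη => by
        rw [Pi.smul_apply, smul_eq_mul, one_le_inv_mul₀ (hψ ζ hζ)]
        exact hmin η hη) hη
    rw [map_smul, Pi.smul_apply, exp_tiltedOp_leadingVector hμ hz hL t hη, smul_eq_mul] at h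
    calc _ ≤ _ := h
      _ = _ := by ring
  have hc1 : 0 < (ψ ξ)⁻¹ * ψ η := mul_pos (inv_pos.2 (hψ ξ hξ)) (hψ η hη)
  have hc2 : 0 < (ψ ζ)⁻¹ * ψ η := mul_pos (inv_pos.2 (hψ ζ hζ)) (hψ η hη)
  have hlog : ∀ c t : ℝ, 0 < c → Real.log (c * Real.exp (topEigenvalue μ (Real.exp s) L * t)) =
      Real.log c + topEigenvalue μ (Real.exp s) L * t := by
    intro c t hc
    rw [Real.log_mul hc.ne' (Real.exp_pos _).ne', Real.log_exp]
  refine tendsto_of_tendsto_of_tendsto_of_le_of_le'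
    (tendsto_add_mul_div (Real.log ((ψ ξ)⁻¹ * ψ η)) (topEigenvalue μ (Real.exp s) L) L)
    (tendsto_add_mul_div (Real.log ((ψ ζ)⁻¹ * ψ η)) (topEigenvalue μ (Real.exp s) L) L) ?_ ?_
  · filter_upwards [eventually_gt_atTop 0] with t ht
    have h0 : 0 < ((ψ ξ)⁻¹ * ψ η) * Real.exp (topEigenvalue μ (Real.exp s) L * t) :=
      mul_pos hc1 (Real.exp_pos _)
    rw [← hlog _ _ hc1]
    gcongr
    exact hlow t ht.le
  · filter_upwards [eventually_gt_atTop 0] with t ht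
    have h0 : 0 < activityMGF (1 / 2) μ L η s t :=
      lt_of_lt_of_le (mul_pos hc1 (Real.exp_pos _)) (hlow t ht.le)
    rw [← hlog _ _ hc2]
    gcongr
    exact hupp t ht.le

/-! ### Smoothness and second derivative of the cumulant generating function -/

lemma energySq_eq (μ z q : ℝ) :
    energySq μ z q = (4 * μ ^ 2 + 1 - 4 * μ * Real.cos q) + 2 * (2 * μ - Real.cos q) * z
      + Real.cos q ^ 2 * z ^ 2 := by
  rw [energySq, Real.sin_sq]
  ring

lemma energySq_pos {μ z q : ℝ} (hμ : 0 < μ) (hz : 0 ≤ z) (hq : Real.cos q ≠ 1) :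
    0 < energySq μ z q := by
  by_cases hs : Real.sin q = 0
  · have h3 : Real.cos q = -1 := by
      have : (Real.cos q - 1) * (Real.cos q + 1) = 0 := by
        have := Real.sin_sq_add_cos_sq q
        rw [hs] at this
        linear_combination this
      rcases mul_eq_zero.1 this with h | h
      · exact absurd (sub_eq_zero.1 h) hq
      · linarith
    rw [energySq, hs, h3]
    have : (2 * μ + z) * -1 - 1 ≠ 0 := by
      have : 0 < 2 * μ + z + 1 := by positivity
      intro h; linarith
    positivity
  · unfold energySq
    positivity

lemma cos_momentum_ne_one {L j : ℕ} (hj : j < L) : Real.cos (momentum L j) ≠ 1 := by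
  intro h
  have h0 := momentum_pos hj
  rw [Real.cos_eq_one_iff_of_lt_of_lt (by linarith [Real.pi_pos]) (momentum_lt hj)] at h
  linarith

/-- Half the derivative of the squared energy with respect to the logarithm of `z`. -/
def energySlope (μ q z : ℝ) : ℝ := (2 * μ - Real.cos q) * z + Real.cos q ^ 2 * z ^ 2

/-- The second logarithmic derivative of the one-particle energy. -/
def energyCurv (μ q z : ℝ) : ℝ :=
  (energySlope μ q z + Real.cos q ^ 2 * z ^ 2) / √(energySq μ z q)
    - energySlope μ q z ^ 2 / √(energySq μ z q) ^ 3

lemma hasDerivAt_energySq (μ q s : ℝ) :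
    HasDerivAt (fun s => energySq μ (Real.exp s) q) (2 * energySlope μ q (Real.exp s)) s := by
  simp only [energySq_eq]
  have h := Real.hasDerivAt_exp s
  refine (((h.const_mul (2 * (2 * μ - Real.cos q))).const_add
    (4 * μ ^ 2 + 1 - 4 * μ * Real.cos q)).add
      ((h.pow 2).const_mul (Real.cos q ^ 2))).congr_deriv ?_
  simp only [energySlope]
  ring

lemma hasDerivAt_sqrt_energySq {μ q : ℝ} (hμ : 0 < μ) (hq : Real.cos q ≠ 1) (s : ℝ) :
    HasDerivAt (fun s => √(energySq μ (Real.exp s) q))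
      (energySlope μ q (Real.exp s) / √(energySq μ (Real.exp s) q)) s := by
  have hpos := energySq_pos hμ (Real.exp_pos s).le hq
  convert (hasDerivAt_energySq μ q s).sqrt hpos.ne' using 1
  rw [mul_div_mul_left _ _ two_ne_zero]

lemma hasDerivAt_energySlope_div {μ q : ℝ} (hμ : 0 < μ) (hq : Real.cos q ≠ 1) (s : ℝ) :
    HasDerivAt (fun s => energySlope μ q (Real.exp s) / √(energySq μ (Real.exp s) q))
      (energyCurv μ q (Real.exp s)) s := by
  have hpos := Real.sqrt_pos.2 (energySq_pos hμ (Real.exp_pos s).le hq)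
  have h := Real.hasDerivAt_exp s
  have h1 : HasDerivAt (fun s => energySlope μ q (Real.exp s))
      (energySlope μ q (Real.exp s) + Real.cos q ^ 2 * Real.exp s ^ 2) s := by
    refine ((h.const_mul (2 * μ - Real.cos q)).add
      ((h.pow 2).const_mul (Real.cos q ^ 2))).congr_deriv ?_
    simp only [energySlope]
    ring
  refine (h1.div (hasDerivAt_sqrt_energySq hμ hq s) hpos.ne').congr_deriv ?_
  simp only [energyCurv]
  field_simp

lemma contDiff_cgf {μ : ℝ} (hμ : 0 < μ) (L : ℕ) : ContDiff ℝ 2 (cgf μ L) := by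
  have h : ∀ j : Fin L, ContDiff ℝ 2 fun s => √(energySq μ (Real.exp s) (momentum L j)) := by
    intro j
    refine ContDiff.sqrt ?_ fun s =>
      (energySq_pos hμ (Real.exp_pos s).le (cos_momentum_ne_one j.isLt)).ne'
    unfold energySq
    fun_prop
  unfold cgf topEigenvalue
  exact (contDiff_const.add (contDiff_const.mul (ContDiff.sum fun j _ => h j))).div_const _

lemma iteratedDeriv_two_cgf {μ : ℝ} (hμ : 0 < μ) (L : ℕ) (s : ℝ) :
    iteratedDeriv 2 (cgf μ L) s =
      1 / 2 * (∑ j : Fin L, energyCurv μ (momentum L j) (Real.exp s)) / L := by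
  have h1 : deriv (cgf μ L) = fun s => 1 / 2 * (∑ j : Fin L, energySlope μ (momentum L j)
      (Real.exp s) / √(energySq μ (Real.exp s) (momentum L j))) / L := by
    funext s
    refine HasDerivAt.deriv ?_
    have := HasDerivAt.fun_sum (u := Finset.univ) fun (j : Fin L) _ =>
      hasDerivAt_sqrt_energySq hμ (cos_momentum_ne_one j.isLt) s
    exact ((this.const_mul (1 / 2)).const_add _).div_const _
  rw [iteratedDeriv_succ, iteratedDeriv_one, h1]
  refine HasDerivAt.deriv ?_
  have := HasDerivAt.fun_sum (u := Finset.univ) fun (j : Fin L) _ =>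
    hasDerivAt_energySlope_div hμ (cos_momentum_ne_one j.isLt) s
  exact (this.const_mul (1 / 2)).div_const _

/-- The energies stay positive at z = 0 because q = 0 is not a momentum, so `energyCurv` is
continuous there; its value is 0 since both numerators carry a factor z. -/
lemma tendsto_iteratedDeriv_two_cgf_atBot {μ : ℝ} (hμ : 0 < μ) (L : ℕ) :
    Tendsto (iteratedDeriv 2 (cgf μ L)) atBot (𝓝 0) := by
  have h : ∀ j : Fin L, Tendsto (fun s => energyCurv μ (momentum L j) (Real.exp s)) atBot (𝓝 0) := by
    intro j
    have hpos := Real.sqrt_pos.2 (energySq_pos hμ le_rfl (cos_momentum_ne_one j.isLt))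
    have hcont : ContinuousAt (energyCurv μ (momentum L j)) 0 := by
      have h1 : ContinuousAt (fun z => √(energySq μ z (momentum L j))) 0 := by
        unfold energySq; fun_prop
      have h2 : ContinuousAt (energySlope μ (momentum L j)) 0 := by
        unfold energySlope; fun_prop
      unfold energyCurv
      refine ContinuousAt.sub (ContinuousAt.div₀ (h2.add (by fun_prop)) h1 hpos.ne')
        (ContinuousAt.div₀ (h2.pow 2) (h1.pow 3) (pow_pos hpos 3).ne')
    have h0 : energyCurv μ (momentum L j) 0 = 0 := by simp [energyCurv, energySlope]
    have := hcont.tendsto.comp Real.tendsto_exp_atBot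
    rwa [h0] at this
  have h2 := (((tendsto_finsetSum Finset.univ fun j _ => h j).const_mul (1 / 2)).div_const (L : ℝ))
  simp only [Finset.sum_const_zero, mul_zero, zero_div] at h2
  exact h2.congr fun s => (iteratedDeriv_two_cgf hμ L s).symm

/-! ### The one-particle curvature at the critical point -/

/-- The bounded part of the critical curvature, as a function of `u = 1 - cos q`. -/
def curvRemainder (ν u : ℝ) : ℝ :=
  ν * (1 - ν * (2 - u)) / √(2 * (1 - ν ^ 2) + ν ^ 2 * u)
    + ν ^ 2 * ((1 - ν) * (2 * u - 5 - ν)) / √(2 * (1 - ν ^ 2) + ν ^ 2 * u) ^ 3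
    - ν ^ 4 * (√(2 * (1 - ν ^ 2) + ν ^ 2 * u) ^ 2
      + √(2 * (1 - ν ^ 2) + ν ^ 2 * u) * √(2 * (1 - ν ^ 2)) + √(2 * (1 - ν ^ 2)) ^ 2) /
      ((√(2 * (1 - ν ^ 2) + ν ^ 2 * u) + √(2 * (1 - ν ^ 2)))
        * √(2 * (1 - ν ^ 2) + ν ^ 2 * u) ^ 3 * √(2 * (1 - ν ^ 2)))

lemma energyCurv_critical {ν q : ℝ} (hν0 : 0 ≤ ν) (hν1 : ν < 1) (hq : Real.cos q ≠ 1) :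
    energyCurv ((1 - ν) / 2) q ν = ν ^ 2 / (√(2 * (1 - ν ^ 2)) * √(1 - Real.cos q))
      + √(1 - Real.cos q) * curvRemainder ν (1 - Real.cos q) := by
  have hu : 0 < 1 - Real.cos q := by
    have := lt_of_le_of_ne (Real.cos_le_one q) hq
    linarith
  have hp0 : 0 < 2 * (1 - ν ^ 2) := by nlinarith
  obtain ⟨u, hu'⟩ : ∃ u, u = 1 - Real.cos q := ⟨_, rfl⟩
  have hc : Real.cos q = 1 - u := by linarith
  rw [← hu'] at hu ⊢
  have hp : 0 < 2 * (1 - ν ^ 2) + ν ^ 2 * u := by positivity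
  have hE : energySq ((1 - ν) / 2) ν q = u * (2 * (1 - ν ^ 2) + ν ^ 2 * u) := by
    rw [energySq_eq, hc]; ring
  rw [energyCurv, hE, Real.sqrt_mul hu.le, energySlope, hc, curvRemainder]
  have hw := Real.sqrt_pos.2 hu
  have hr := Real.sqrt_pos.2 hp
  have hr0 := Real.sqrt_pos.2 hp0
  have ew := Real.sq_sqrt hu.le
  have er := Real.sq_sqrt hp.le
  have er0 := Real.sq_sqrt hp0.le
  generalize √u = w at *
  generalize √(2 * (1 - ν ^ 2) + ν ^ 2 * u) = r at *
  generalize √(2 * (1 - ν ^ 2)) = r0 at *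
  have hrr : r + r0 ≠ 0 := by positivity
  subst ew
  -- Here w² = u, r² = 2(1 - ν²) + ν²u, and r0 is r at u = 0. Written this way, the square of
  -- `energySlope` cancels between the two terms of `energyCurv`.
  have hM : (1 - w ^ 2) ^ 2 * ν ^ 2 * (w ^ 2 * r ^ 2) = (ν * w ^ 2 * (1 - ν * (2 - w ^ 2))) ^ 2
      + ν ^ 2 * w ^ 2 * (r0 ^ 2 + w ^ 2 * ((1 - ν) * (2 * w ^ 2 - 5 - ν))) := by
    rw [er, er0]; ring
  have hN : (2 * ((1 - ν) / 2) - (1 - w ^ 2)) * ν + (1 - w ^ 2) ^ 2 * ν ^ 2 =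
      ν * w ^ 2 * (1 - ν * (2 - w ^ 2)) := by ring
  have hA : (ν * w ^ 2 * (1 - ν * (2 - w ^ 2)) + (1 - w ^ 2) ^ 2 * ν ^ 2) / (w * r)
      - (ν * w ^ 2 * (1 - ν * (2 - w ^ 2))) ^ 2 / (w * r) ^ 3 =
      w * (ν * (1 - ν * (2 - w ^ 2)) / r)
        + ν ^ 2 * (r0 ^ 2 + w ^ 2 * ((1 - ν) * (2 * w ^ 2 - 5 - ν))) / (w * r ^ 3) := by
    have h1 : (1 - w ^ 2) ^ 2 * ν ^ 2 = ((ν * w ^ 2 * (1 - ν * (2 - w ^ 2))) ^ 2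
        + ν ^ 2 * w ^ 2 * (r0 ^ 2 + w ^ 2 * ((1 - ν) * (2 * w ^ 2 - 5 - ν)))) / (w ^ 2 * r ^ 2) := by
      rw [← hM]; field_simp
    rw [h1]
    field_simp
    ring
  -- Replacing r by r0 in the singular term costs only O(w), because r² - r0² = ν²w².
  have hB : ν ^ 2 * r0 ^ 2 / (w * r ^ 3) = ν ^ 2 / (r0 * w)
      - w * (ν ^ 4 * (r ^ 2 + r * r0 + r0 ^ 2) / ((r + r0) * r ^ 3 * r0)) := by
    have h1 : (r ^ 3 - r0 ^ 3) * (r + r0) = w ^ 2 * ν ^ 2 * (r ^ 2 + r * r0 + r0 ^ 2) := by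
      linear_combination (r ^ 2 + r * r0 + r0 ^ 2) * (er - er0)
    have h2 : w * (ν ^ 4 * (r ^ 2 + r * r0 + r0 ^ 2) / ((r + r0) * r ^ 3 * r0)) =
        ν ^ 2 * ((r ^ 3 - r0 ^ 3) * (r + r0)) / (w * ((r + r0) * r ^ 3 * r0)) := by
      rw [h1]; field_simp
    rw [h2]
    field_simp
    ring
  rw [hN, hA, mul_add, add_div, hB]
  field_simp
  ring

lemma exists_curvRemainder_bound {ν : ℝ} (hν0 : 0 ≤ ν) (hν1 : ν < 1) :
    ∃ C, ∀ u ∈ Set.Icc (0 : ℝ) 2, ‖curvRemainder ν u‖ ≤ C := by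
  have hp0 : 0 < 2 * (1 - ν ^ 2) := by nlinarith
  have hr0 := Real.sqrt_pos.2 hp0
  refine isCompact_Icc.exists_bound_of_continuousOn fun u hu => ContinuousAt.continuousWithinAt ?_
  have hp : 0 < 2 * (1 - ν ^ 2) + ν ^ 2 * u := by
    have := hu.1
    positivity
  have hr := Real.sqrt_pos.2 hp
  have h1 : ContinuousAt (fun u : ℝ => √(2 * (1 - ν ^ 2) + ν ^ 2 * u)) u := by fun_prop
  unfold curvRemainder
  refine ContinuousAt.sub (ContinuousAt.add (ContinuousAt.div₀ (by fun_prop) h1 hr.ne')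
    (ContinuousAt.div₀ (by fun_prop) (h1.pow 3) (by positivity)))
    (ContinuousAt.div₀ (by fun_prop) (by fun_prop) (by positivity))

lemma exists_energyCurv_bound {ν : ℝ} (hν0 : 0 ≤ ν) (hν1 : ν < 1) :
    ∃ C, ∀ q, Real.cos q ≠ 1 →
      |energyCurv ((1 - ν) / 2) q ν - ν ^ 2 / (√(2 * (1 - ν ^ 2)) * √(1 - Real.cos q))| ≤ C := by
  obtain ⟨C, hC⟩ := exists_curvRemainder_bound hν0 hν1
  refine ⟨√2 * C, fun q hq => ?_⟩
  have h1 := Real.cos_le_one q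
  have h2 := Real.neg_one_le_cos q
  rw [energyCurv_critical hν0 hν1 hq, add_sub_cancel_left, abs_mul, abs_of_nonneg (Real.sqrt_nonneg _)]
  exact mul_le_mul (Real.sqrt_le_sqrt (by linarith))
    (hC _ ⟨by linarith, by linarith⟩) (abs_nonneg _) (Real.sqrt_nonneg _)

/-! ### Logarithmic growth of the sum over momenta -/

lemma inv_sin_sub_le_of_le {x : ℝ} (h0 : 0 < x) (h1 : x ≤ Real.pi / 2) :
    |(Real.sin x)⁻¹ - (x⁻¹ + (Real.pi - x)⁻¹)| ≤ 1 := by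
  have hpi := Real.pi_gt_three
  have hs : 0 < Real.sin x := Real.sin_pos_of_pos_of_lt_pi h0 (by linarith)
  have hs1 := Real.sin_le_one x
  have hc : 0 ≤ Real.cos x := Real.cos_nonneg_of_neg_pi_div_two_le_of_le (by linarith) h1
  have hc1 := Real.cos_le_one x
  have h2 : x⁻¹ ≤ (Real.sin x)⁻¹ := inv_anti₀ hs (Real.sin_le h0.le)
  have h3 : x * Real.cos x ≤ Real.sin x := by
    rcases h1.lt_or_eq with h | h
    · have hc' : 0 < Real.cos x := Real.cos_pos_of_mem_Ioo ⟨by linarith, h⟩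
      have := Real.le_tan h0.le h
      rwa [Real.tan_eq_sin_div_cos, le_div_iff₀ hc'] at this
    · rw [h, Real.cos_pi_div_two, mul_zero, Real.sin_pi_div_two]; exact zero_le_one
  -- Compare through cot x: cot x ≤ 1/x follows from x ≤ tan x, and (1 - cos x)/sin x ≤ 1 on the
  -- first quadrant.
  have h4 : (Real.sin x)⁻¹ - x⁻¹ ≤ 1 := by
    have e1 : Real.cos x / Real.sin x ≤ x⁻¹ := by
      rw [div_le_iff₀ hs, inv_mul_eq_div, le_div_iff₀ h0]
      linarith
    have e2 : (Real.sin x)⁻¹ - Real.cos x / Real.sin x ≤ 1 := by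
      rw [inv_eq_one_div, ← sub_div, div_le_one hs]
      nlinarith [Real.sin_sq_add_cos_sq x]
    linarith
  have h5 : 0 < (Real.pi - x)⁻¹ := inv_pos.2 (by linarith)
  have h6 : (Real.pi - x)⁻¹ ≤ 1 := inv_le_one_of_one_le₀ (by linarith)
  rw [abs_le]
  constructor <;> linarith

lemma inv_sin_sub_le {x : ℝ} (h0 : 0 < x) (h1 : x < Real.pi) :
    |(Real.sin x)⁻¹ - (x⁻¹ + (Real.pi - x)⁻¹)| ≤ 1 := by
  rcases le_total x (Real.pi / 2) with h | h
  · exact inv_sin_sub_le_of_le h0 h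
  · have := inv_sin_sub_le_of_le (x := Real.pi - x) (by linarith) (by linarith)
    rwa [Real.sin_pi_sub, sub_sub_cancel, add_comm] at this

lemma sum_inv_odd (L : ℕ) :
    ∑ j ∈ Finset.range L, (2 * (j : ℝ) + 1)⁻¹ = harmonic (2 * L) - 1 / 2 * harmonic L := by
  induction L with
  | zero => simp
  | succ L ih =>
    rw [Finset.sum_range_succ, ih, show 2 * (L + 1) = 2 * L + 1 + 1 from rfl, harmonic_succ,
      harmonic_succ, harmonic_succ]
    push_cast
    field_simp
    ring

lemma abs_sum_inv_odd_sub_le {L : ℕ} (hL : 1 ≤ L) :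
    |∑ j ∈ Finset.range L, (2 * (j : ℝ) + 1)⁻¹ - 1 / 2 * Real.log L| ≤ 2 := by
  have h0 : (0 : ℝ) < L := Nat.cast_pos.2 hL
  rw [sum_inv_odd]
  have a1 := log_add_one_le_harmonic (2 * L)
  have a2 := harmonic_le_one_add_log (2 * L)
  have a3 := log_add_one_le_harmonic L
  have a4 := harmonic_le_one_add_log L
  have e1 : Real.log ((2 * L : ℕ) : ℝ) = Real.log 2 + Real.log L := by
    push_cast; rw [Real.log_mul two_ne_zero h0.ne']
  have e2 : Real.log ((2 * L : ℕ) : ℝ) ≤ Real.log (((2 * L : ℕ) : ℝ) + 1) :=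
    Real.log_le_log (by positivity) (by linarith)
  have e3 : Real.log (L : ℝ) ≤ Real.log ((L : ℝ) + 1) := Real.log_le_log h0 (by linarith)
  have e4 := Real.log_two_lt_d9
  have e5 := Real.log_two_gt_d9
  push_cast at *
  rw [abs_le]
  constructor <;> linarith

/-- The poles of 1/sin at 0 and π contribute equally by the reflection q ↦ 2π - q. Together they
give (4/π) Σ 1/(2j + 1) after division by L, and the odd harmonic sum is ½ log L + O(1). -/
lemma abs_sum_inv_sin_sub_le {L : ℕ} (hL : 1 ≤ L) :
    |(∑ j : Fin L, (Real.sin (momentum L j / 2))⁻¹) / L - 2 / Real.pi * Real.log L| ≤ 4 := by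
  have h0 : (0 : ℝ) < L := Nat.cast_pos.2 hL
  have hpi := Real.pi_gt_three
  have h1 : ∑ j : Fin L, ((momentum L j / 2)⁻¹ + (Real.pi - momentum L j / 2)⁻¹) =
      L * (4 / Real.pi * ∑ j ∈ Finset.range L, (2 * (j : ℝ) + 1)⁻¹) := by
    have e1 : ∑ j : Fin L, (Real.pi - momentum L j / 2)⁻¹ = ∑ j : Fin L, (momentum L j / 2)⁻¹ := by
      rw [← Equiv.sum_comp Fin.revPerm]
      refine Finset.sum_congr rfl fun j _ => ?_
      rw [Fin.revPerm_apply, momentum_rev]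
      congr 1
      ring
    rw [Finset.sum_add_distrib, e1, ← Fin.sum_univ_eq_sum_range (fun j => (2 * (j : ℝ) + 1)⁻¹) L,
      ← mul_assoc, Finset.mul_sum, ← Finset.sum_add_distrib]
    refine Finset.sum_congr rfl fun j _ => ?_
    rw [momentum]
    field_simp
    ring
  have h2 : |∑ j : Fin L, (Real.sin (momentum L j / 2))⁻¹
      - ∑ j : Fin L, ((momentum L j / 2)⁻¹ + (Real.pi - momentum L j / 2)⁻¹)| ≤ L := by
    rw [← Finset.sum_sub_distrib]
    refine (Finset.abs_sum_le_sum_abs _ _).trans ?_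
    refine (Finset.sum_le_sum fun (j : Fin L) _ => inv_sin_sub_le (x := momentum L j / 2)
      (half_pos (momentum_pos j.isLt)) (by have := momentum_lt j.isLt; linarith)).trans ?_
    simp
  rw [h1] at h2
  have h3 := abs_sum_inv_odd_sub_le hL
  generalize ∑ j : Fin L, (Real.sin (momentum L j / 2))⁻¹ = S at *
  generalize ∑ j ∈ Finset.range L, (2 * (j : ℝ) + 1)⁻¹ = H at *
  have h4 : |S / L - 4 / Real.pi * H| ≤ 1 := by
    have : S / L - 4 / Real.pi * H = (S - L * (4 / Real.pi * H)) / L := by field_simp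
    rw [this, abs_div, abs_of_pos h0, div_le_one h0]
    exact h2
  have h5 : |4 / Real.pi * H - 2 / Real.pi * Real.log L| ≤ 3 := by
    have : 4 / Real.pi * H - 2 / Real.pi * Real.log L =
        4 / Real.pi * (H - 1 / 2 * Real.log L) := by ring
    rw [this, abs_mul, abs_of_pos (by positivity)]
    have h6 : 4 / Real.pi ≤ 3 / 2 := by
      rw [div_le_iff₀ (by positivity)]; linarith
    calc _ ≤ 3 / 2 * 2 := mul_le_mul h6 h3 (abs_nonneg _) (by norm_num)
      _ = 3 := by norm_num
  calc _ = |(S / L - 4 / Real.pi * H) + (4 / Real.pi * H - 2 / Real.pi * Real.log L)| := by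
        congr 1; ring
    _ ≤ 1 + 3 := (abs_add_le _ _).trans (add_le_add h4 h5)
    _ = 4 := by norm_num

/-! ### The critical variance -/

lemma sqrt_one_sub_cos {L j : ℕ} (hj : j < L) :
    √(1 - Real.cos (momentum L j)) = √2 * Real.sin (momentum L j / 2) := by
  have hs : 0 ≤ Real.sin (momentum L j / 2) :=
    Real.sin_nonneg_of_nonneg_of_le_pi (by linarith [momentum_pos hj])
      (by linarith [momentum_lt hj])
  have : 1 - Real.cos (momentum L j) = 2 * Real.sin (momentum L j / 2) ^ 2 := by
    have := Real.cos_two_mul' (momentum L j / 2)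
    rw [mul_div_cancel₀ _ two_ne_zero, Real.cos_sq'] at this
    linarith
  rw [this, Real.sqrt_mul zero_le_two, Real.sqrt_sq hs]

lemma exists_variance_bound {ν : ℝ} (hν0 : 0 < ν) (hν1 : ν < 1) :
    ∃ C, ∀ L : ℕ, 1 ≤ L → |iteratedDeriv 2 (cgf ((1 - ν) / 2) L) (Real.log ν)
      - ν ^ 2 / (2 * Real.pi * √(1 - ν ^ 2)) * Real.log L| ≤ C := by
  obtain ⟨C, hC⟩ := exists_energyCurv_bound hν0.le hν1
  -- `B` is the coefficient of 1/sin(q/2) in the singular curvature, since √(1 - cos q) = √2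
  -- sin(q/2).
  set B := ν ^ 2 / (2 * √(1 - ν ^ 2)) with hB
  have hB0 : 0 ≤ B := by positivity
  refine ⟨1 / 2 * C + 1 / 2 * B * 4, fun L hL => ?_⟩
  have h0 : (0 : ℝ) < L := Nat.cast_pos.2 hL
  rw [iteratedDeriv_two_cgf (by linarith), Real.exp_log hν0]
  have h1 : |∑ j : Fin L, energyCurv ((1 - ν) / 2) (momentum L j) ν
      - B * ∑ j : Fin L, (Real.sin (momentum L j / 2))⁻¹| ≤ L * C := by
    rw [Finset.mul_sum, ← Finset.sum_sub_distrib]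
    refine (Finset.abs_sum_le_sum_abs _ _).trans ?_
    have : ∀ j : Fin L, |energyCurv ((1 - ν) / 2) (momentum L j) ν
        - B * (Real.sin (momentum L j / 2))⁻¹| ≤ C := by
      intro j
      convert hC _ (cos_momentum_ne_one j.isLt) using 3
      rw [sqrt_one_sub_cos j.isLt, Real.sqrt_mul zero_le_two, hB, ← div_eq_mul_inv, div_div]
      congr 1
      have := Real.mul_self_sqrt (zero_le_two (α := ℝ))
      linear_combination (-√(1 - ν ^ 2) * Real.sin (momentum L j / 2)) * this
    refine (Finset.sum_le_sum fun j _ => this j).trans ?_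
    simp
  have h2 := abs_sum_inv_sin_sub_le hL
  generalize ∑ j : Fin L, energyCurv ((1 - ν) / 2) (momentum L j) ν = X at *
  generalize ∑ j : Fin L, (Real.sin (momentum L j / 2))⁻¹ = S at *
  have h3 : ν ^ 2 / (2 * Real.pi * √(1 - ν ^ 2)) = 1 / 2 * B * (2 / Real.pi) := by
    rw [hB]
    have : 0 < √(1 - ν ^ 2) := Real.sqrt_pos.2 (by nlinarith)
    have := Real.pi_pos
    field_simp
  have h4 : |(X - B * S) / L| ≤ C := by
    rw [abs_div, abs_of_pos h0, div_le_iff₀ h0, mul_comm C]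
    exact h1
  calc _ = |1 / 2 * ((X - B * S) / L) + 1 / 2 * B * (S / L - 2 / Real.pi * Real.log L)| := by
        rw [h3]; congr 1; ring
    _ ≤ |1 / 2 * ((X - B * S) / L)| + |1 / 2 * B * (S / L - 2 / Real.pi * Real.log L)| :=
        abs_add_le _ _
    _ ≤ 1 / 2 * C + 1 / 2 * B * 4 := by
        rw [abs_mul, abs_mul, abs_of_pos (by norm_num : (0 : ℝ) < 1 / 2),
          abs_of_nonneg (by positivity : 0 ≤ 1 / 2 * B)]
        gcongr

lemma isEquivalent_of_abs_sub_le {u v : ℕ → ℝ} {C : ℝ} (hv : Tendsto v atTop atTop)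
    (h : ∀ᶠ n in atTop, |u n - v n| ≤ C) : u ~[atTop] v := by
  have h1 : (u - v) =O[atTop] fun _ => (1 : ℝ) :=
    IsBigO.of_bound C (h.mono fun n hn => by simpa using hn)
  refine h1.trans_isLittleO ?_
  rw [isLittleO_one_left_iff]
  exact tendsto_norm_atTop_atTop.comp hv

end DLPAD

end

/-- The critical variance of the activity. The jump rate is `w = 1/2` and the deposition rate is
`μ = (1 - ν)/2`, so that `ν = 1 - μ / w`; the critical point is `s_c = log ν`, with `s_c = -∞`
for `ν = 0`, where the critical variance is the limit of the second cumulant as `s → -∞`. -/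
theorem mainTheorem5 (ν : ℝ) (hν0 : 0 ≤ ν) (hν1 : ν < 1) :
    ∃ (K : ℕ → ℝ → ℝ) (V : ℕ → ℝ),
      (∀ L : ℕ, 2 ≤ L →
        DLPAD.IsEvenCGF (1 / 2) ((1 - ν) / 2) L (K L) ∧
        ContDiff ℝ 2 (K L) ∧
        (0 < ν → V L = iteratedDeriv 2 (K L) (Real.log ν)) ∧
        (ν = 0 → Tendsto (iteratedDeriv 2 (K L)) atBot (𝓝 (V L)))) ∧
      (V ~[atTop] fun L : ℕ =>
        ν ^ 2 / (2 * Real.pi * Real.sqrt (1 - ν ^ 2)) * Real.log L) ∧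
      (0 < ν → Tendsto V atTop atTop) := by
  have hμ : 0 < (1 - ν) / 2 := by linarith
  have hequiv : 0 < ν → (fun L => iteratedDeriv 2 (DLPAD.cgf ((1 - ν) / 2) L) (Real.log ν)) ~[atTop]
      (fun L : ℕ => ν ^ 2 / (2 * Real.pi * Real.sqrt (1 - ν ^ 2)) * Real.log L) ∧
      Tendsto (fun L : ℕ => ν ^ 2 / (2 * Real.pi * Real.sqrt (1 - ν ^ 2)) * Real.log L)
        atTop atTop := by
    intro hν
    have hs : 0 < Real.sqrt (1 - ν ^ 2) := Real.sqrt_pos.2 (by nlinarith)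
    have hc : 0 < ν ^ 2 / (2 * Real.pi * Real.sqrt (1 - ν ^ 2)) := by
      have := Real.pi_pos
      positivity
    have ht := (Real.tendsto_log_atTop.comp tendsto_natCast_atTop_atTop).const_mul_atTop hc
    obtain ⟨C, hC⟩ := DLPAD.exists_variance_bound hν hν1
    exact ⟨DLPAD.isEquivalent_of_abs_sub_le ht ((eventually_ge_atTop 1).mono hC), ht⟩
  -- The case ν = 0 is separated because `Real.log 0 = 0` would evaluate the derivative at s = 0
  -- instead of at s = -∞.
  refine ⟨DLPAD.cgf ((1 - ν) / 2), fun L => if ν = 0 then 0 else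
    iteratedDeriv 2 (DLPAD.cgf ((1 - ν) / 2) L) (Real.log ν), fun L hL =>
    ⟨DLPAD.isEvenCGF_cgf hμ hL, DLPAD.contDiff_cgf hμ L, fun h => if_neg h.ne', fun h => ?_⟩, ?_, ?_⟩
  · simp only [if_pos h]
    exact DLPAD.tendsto_iteratedDeriv_two_cgf_atBot hμ L
  · rcases hν0.eq_or_lt with h | h
    · subst h
      simpa using IsEquivalent.refl
    · simp only [if_neg h.ne']
      exact (hequiv h).1
  · intro h
    simp only [if_neg h.ne']
    exact (hequiv h).1.symm.tendsto_atTop (hequiv h).2
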